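/- Let $(X,\rho)$ be a compact metric space and let $f\colon X\to X$ be continuous, open and topologically transitive (for all nonempty open $U,V\subseteq X$ there is $n\ge 1$ with $f^n(U)\cap V\ne\emptyset$). Let $\xi>0$ and $\lambda>1$ be such that $\rho(f(x),f(y))\ge\lambda\rho(x,y)$ whenever $\rho(x,y)\le\xi$, and such that for every $x\in X$ the restriction of $f$ to the ball $B(x,\xi)$ is a homeomorphism onto its image. Let $\alpha=\{A_i\}_{i\in I}$ be a finite Markov partition, i.e. a finite cover of $X$ by nonempty sets with $A_i=\overline{\operatorname{int}A_i}$, with $\operatorname{int}A_i\cap\operatorname{int}A_j=\emptyset$ for $i\neq j$, and such that $f(\operatorname{int}A_i)\cap\operatorname{int}A_j\ne\emptyset$ implies $\operatorname{int}A_j\subseteq f(\operatorname{int}A_i)$. Assume that $\operatorname{diam}A_i<\xi$ for all $i$. The vertices of the tile graph $\Gamma=\Gamma(f,\alpha)$ are the finite words $u=u_1\cdots u_n$ ($n\ge 0$) over $I$ with $A_{u_{i+1}}\subseteq f(A_{u_i})$ for $1\le i<n$. Put $|u|=n$, let $o$ be the empty word, and put $A_u=A_{u_1}\cap f^{-1}A_{u_2}\cap\cdots\cap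 f^{-(n-1)}A_{u_n}$, $A_o=X$. Distinct $u,v$ are adjacent if $\bigl||u|-|v|\bigr|\le1$ and $A_u\cap A_v\neq\emptyset$; $d$ is the graph distance. The shift is $\sigma(u_1u_2\cdots u_n)=u_2\cdots u_n$, $\sigma(o)=o$. Let $P$ assign to each vertex a probability measure on $\Gamma$, write $\hat P(x,y)=P(x)(\{y\})$, and assume: (A) there is $R>0$ such that $\hat P(x,y)>0$ implies $d(x,y)<R$; (B) $\hat P(x,y)>0$ implies $|y|>|x|$; (C) $|y|=|x|+1$ and $d(x,y)=1$ imply $\hat P(x,y)>0$; (D) $P(\sigma u)=\sigma_*P(u)$ for every $u\ne o$. Let $G(x,y)=\sum_{n\ge0}\hat P^{(n)}(x,y)$ be the Green function, $K(u,v)=G(u,v)/G(o,v)$ the Martin kernel, $\hat K(v)=K(\cdot,v)\in\mathbb R^\Gamma$, and let $\partial_M\Gamma=\overline{\hat K(\Gamma)}\setminus\hat K(\Gamma)$ be the Martin boundary, where $\mathbb R^\Gamma$ has the topology of pointwise convergence. Give $\Gamma\cup\partial_M\Gamma$ the topology pulled back from $\mathbb R^\Gamma$, a vertex $v$ being regarded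 as $\hat K(v)$. Let $\partial\Gamma$ be the Gromov boundary of $(\Gamma,d)$ (sequences of vertices converging at infinity, modulo equivalence), and give $\Gamma\cup\partial\Gamma$ the usual topology: vertices are isolated, and a boundary point $\zeta$ has the basic neighbourhoods $\{p:(\zeta,p)_o\ge r\}$, $r\in\mathbb R$, where $(\cdot,\cdot)_o$ is the extended Gromov product. Then $\Gamma$ is connected, $G$ is finite, and $G(o,v)>0$ for every $v$, so that $d$ and $K$ are well defined. Moreover: 1. $(\Gamma,d)$ is Gromov hyperbolic, and $\partial\Gamma$ is naturally homeomorphic to $X$: there is a homeomorphism $\Psi\colon\partial\Gamma\to X$ such that, whenever vertices $u_n$ converge to $\zeta\in\partial\Gamma$, the sets $A_{u_n}$ converge to $\{\Psi(\zeta)\}$ in the Hausdorff distance. 2. The identity map on $\Gamma$ extends continuously to a surjection from the Martin boundary onto the Gromov boundary: there is a continuous surjection $\Phi\colon\partial_M\Gamma\to\partial\Gamma$ such that $\mathrm{id}_\Gamma\cup\Phi\colon\Gamma\cup\partial_M\Gamma\to\Gamma\cup\partial\Gamma$ is continuous. -/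

import Mathlib

open Set Filter Topology
open scoped ENNReal

/-! ### Open, transitive, distance-expanding maps and Markov partitions -/

/-- `f` is continuous, topologically transitive, open and distance-expanding with constants
`ξ > 0` and `lam > 1`, where `ξ` is small enough for `f` to be a homeomorphism onto its image
on every ball of radius `ξ`. -/
structure IsOpenExpanding {X : Type*} [MetricSpace X] (f : X → X) (ξ lam : ℝ) : Prop where
  continuous : Continuous f
  transitive : ∀ U V : Set X, IsOpen U → U.Nonempty → IsOpen V → V.Nonempty →
    ∃ n : ℕ, 0 < n ∧ ((f^[n] '' U) ∩ V).Nonempty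
  isOpenMap : IsOpenMap f
  xi_pos : 0 < ξ
  one_lt_lam : 1 < lam
  expanding : ∀ x y : X, dist x y ≤ ξ → lam * dist x y ≤ dist (f x) (f y)
  isEmbedding : ∀ x : X, IsEmbedding ((Metric.ball x ξ).domRestrict f)

/-- A Markov partition of `X` for `f`, as an indexed family of nonempty sets
(indexed by a finite type where it is used). -/
structure IsMarkovPartition {X ι : Type*} [TopologicalSpace X] (f : X → X) (A : ι → Set X) :
    Prop where
  cover : ⋃ i, A i = univ
  nonempty : ∀ i, (A i).Nonempty
  closure_interior : ∀ i, A i = closure (interior (A i))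
  disjoint : ∀ i j, i ≠ j → interior (A i) ∩ interior (A j) = ∅
  markov : ∀ i j, ((f '' interior (A i)) ∩ interior (A j)).Nonempty →
    interior (A j) ⊆ f '' interior (A i)

/-! ### The tile graph -/

/-- Vertices of the tile graph: the admissible words `u₁ ⋯ uₙ` (`n ≥ 0`), those with
`A_{u_{i+1}} ⊆ f (A_{u_i})` for all `1 ≤ i < n`. -/
def TileVertex {X ι : Type*} (f : X → X) (A : ι → Set X) : Type _ :=
  {u : List ι // u.IsChain (fun i j => A j ⊆ f '' A i)}

namespace TileVertex

variable {X ι : Type*} {f : X → X} {A : ι → Set X}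

/-- The level `|u|`. -/
def level (u : TileVertex f A) : ℕ := u.1.length

/-- The basepoint `o`, the empty word. -/
def root : TileVertex f A := ⟨[], List.isChain_nil⟩

/-- The tile `A_u = A_{u₁} ∩ f⁻¹ A_{u₂} ∩ ⋯ ∩ f^{-(n-1)} A_{uₙ}`; it is `X` if `u` is empty. -/
def tile (u : TileVertex f A) : Set X :=
  {x | ∀ i : Fin u.1.length, f^[(i : ℕ)] x ∈ A (u.1.get i)}

/-- The shift `u₁ u₂ ⋯ uₙ ↦ u₂ ⋯ uₙ`, which sends words of length at most one to `o`. -/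
def shift (u : TileVertex f A) : TileVertex f A := ⟨u.1.tail, u.2.tail⟩

end TileVertex

/-- The tile graph: distinct words are joined if their levels differ by at most one and their
tiles meet. -/
def tileGraph {X ι : Type*} (f : X → X) (A : ι → Set X) : SimpleGraph (TileVertex f A) where
  Adj u v := u ≠ v ∧ (u.level ≤ v.level + 1 ∧ v.level ≤ u.level + 1) ∧
    (u.tile ∩ v.tile).Nonempty
  symm := ⟨fun _ _ h => ⟨h.1.symm, h.2.1.symm, by rw [inter_comm]; exact h.2.2⟩⟩
  loopless := ⟨fun _ h => h.1 rfl⟩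

/-! ### Gromov hyperbolicity, the Gromov boundary and its compactification -/

section Gromov

variable {V : Type*}

/-- The Gromov product `(u, v)_w` for the combinatorial distance. -/
noncomputable def gromovProduct (G : SimpleGraph V) (w u v : V) : ℝ :=
  ((G.dist u w : ℝ) + (G.dist w v : ℝ) - (G.dist u v : ℝ)) / 2

/-- Gromov hyperbolicity through the four-point condition. -/
def GromovHyperbolic (G : SimpleGraph V) : Prop :=
  ∃ δ : ℝ, 0 ≤ δ ∧ ∀ x y z w : V,
    min (gromovProduct G w x z) (gromovProduct G w z y) - δ ≤ gromovProduct G w x y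

/-- The sequence `s` converges at infinity: `(s_i, s_j)_o → ∞` as `i, j → ∞`. -/
def ConvergesAtInfinity (G : SimpleGraph V) (o : V) (s : ℕ → V) : Prop :=
  Tendsto (fun p : ℕ × ℕ => gromovProduct G o (s p.1) (s p.2)) atTop atTop

/-- The Gromov boundary: sequences converging at infinity modulo `(s_n, t_n)_o → ∞`.
(That relation is an equivalence relation if the graph is hyperbolic.) -/
def GromovBoundary (G : SimpleGraph V) (o : V) : Type _ :=
  Quot (fun s t : {s : ℕ → V // ConvergesAtInfinity G o s} =>
    Tendsto (fun n => gromovProduct G o (s.1 n) (t.1 n)) atTop atTop)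

/-- The union of the vertex set and the Gromov boundary. -/
def GromovCompactification (G : SimpleGraph V) (o : V) : Type _ :=
  V ⊕ GromovBoundary G o

namespace GromovCompactification

variable {G : SimpleGraph V} {o : V}

/-- A vertex as a point of the compactification. -/
def ofVertex (v : V) : GromovCompactification G o := Sum.inl v

/-- A boundary point as a point of the compactification. -/
def ofBoundary (ζ : GromovBoundary G o) : GromovCompactification G o := Sum.inr ζ

/-- The sequence of vertices `s` represents a point: it is constant, equal to the given vertex,
or it converges at infinity and its class is the given boundary point. -/
def Represents (s : ℕ → V) : GromovCompactification G o → Prop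
  | Sum.inl v => ∀ n, s n = v
  | Sum.inr ζ => ∃ h : ConvergesAtInfinity G o s, Quot.mk _ ⟨s, h⟩ = ζ

/-- The extension of the Gromov product based at `o` to vertices and boundary points, with
values in the extended reals: the infimum of `liminf_{i,j} (s_i, t_j)_o` over all sequences
`s`, `t` that represent the two points. -/
noncomputable def product (p q : GromovCompactification G o) : EReal :=
  ⨅ (s : ℕ → V) (t : ℕ → V) (_ : Represents s p) (_ : Represents t q),
    liminf (fun k : ℕ × ℕ => ((gromovProduct G o (s k.1) (t k.2) : ℝ) : EReal)) atTop

/-- The standard topology: vertices are isolated, and the sets `{p | (ζ, p)_o ≥ r}` with `r` real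
are a basis of neighbourhoods of a boundary point `ζ`. -/
instance : TopologicalSpace (GromovCompactification G o) where
  IsOpen U := ∀ ζ : GromovBoundary G o, ofBoundary ζ ∈ U →
    ∃ r : ℝ, {p | (r : EReal) ≤ product (ofBoundary ζ) p} ⊆ U
  isOpen_univ := fun _ _ => ⟨0, subset_univ _⟩
  isOpen_inter := fun U W hU hW ζ hζ => by
    obtain ⟨r, hr⟩ := hU ζ hζ.1
    obtain ⟨r', hr'⟩ := hW ζ hζ.2
    refine ⟨max r r', fun p hp => ⟨hr ?_, hr' ?_⟩⟩
    · exact le_trans (EReal.coe_le_coe_iff.2 (le_max_left r r')) hp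
    · exact le_trans (EReal.coe_le_coe_iff.2 (le_max_right r r')) hp
  isOpen_sUnion := fun S hS ζ hζ => by
    obtain ⟨U, hU, hζU⟩ := hζ
    obtain ⟨r, hr⟩ := hS U hU ζ hζU
    exact ⟨r, hr.trans (subset_sUnion_of_mem hU)⟩

end GromovCompactification

/-- The Gromov boundary carries the topology of a subspace of the compactification. -/
instance (G : SimpleGraph V) (o : V) : TopologicalSpace (GromovBoundary G o) :=
  TopologicalSpace.induced GromovCompactification.ofBoundary inferInstance

end Gromov

/-! ### Green function, Martin kernel and Martin boundary of a Markov chain -/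

section Martin

variable {V : Type*}

/-- The `n`-step transition probabilities. -/
noncomputable def stepN (P : V → PMF V) : ℕ → V → PMF V
  | 0, x => PMF.pure x
  | n + 1, x => (P x).bind (stepN P n)

/-- The Green function `G(x, y) = ∑ₙ P⁽ⁿ⁾(x, y)`. -/
noncomputable def green (P : V → PMF V) (x y : V) : ℝ≥0∞ := ∑' n : ℕ, stepN P n x y

/-- The Martin kernel `K(u, v) = G(u, v) / G(o, v)`, as the map `v ↦ K(·, v)`. -/
noncomputable def martinKernel (P : V → PMF V) (o : V) (v : V) : V → ℝ :=
  fun u => (green P u v).toReal / (green P o v).toReal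

/-- The Martin boundary, in the space of real functions on `V` with the topology of pointwise
convergence. -/
def MartinBoundary (P : V → PMF V) (o : V) : Set (V → ℝ) :=
  closure (range (martinKernel P o)) \ range (martinKernel P o)

/-- The union of `V` and the Martin boundary. -/
def MartinCompactification (P : V → PMF V) (o : V) : Type _ :=
  V ⊕ MartinBoundary P o

/-- The topology pulled back from pointwise convergence, where `v` is regarded as `K(·, v)`. -/
noncomputable instance (P : V → PMF V) (o : V) : TopologicalSpace (MartinCompactification P o) :=
  TopologicalSpace.induced
    (Sum.elim (martinKernel P o) Subtype.val : V ⊕ MartinBoundary P o → V → ℝ) inferInstance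

/-- The map between the two compactifications which is the identity on `V` and `Φ` on the
Martin boundary. -/
def extendId {P : V → PMF V} {G : SimpleGraph V} {o : V}
    (Φ : MartinBoundary P o → GromovBoundary G o) :
    MartinCompactification P o → GromovCompactification G o :=
  Sum.map id Φ

end Martin

/-! ### The class of random walks -/

/-- The standing assumptions on a transition probability on the tile graph: steps of bounded
length, strictly increasing level, positive probability of moving to each neighbour of the next
level, and invariance under the shift. -/
structure IsTileWalk {X ι : Type*} {f : X → X} {A : ι → Set X}
    (P : TileVertex f A → PMF (TileVertex f A)) : Prop where
  bounded_step : ∃ R : ℝ, 0 < R ∧ ∀ x, (P x).support ⊆ {y | ((tileGraph f A).dist x y : ℝ) < R}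
  level_lt : ∀ x y, 0 < P x y → x.level < y.level
  pos_of_adj : ∀ x y, y.level = x.level + 1 → (tileGraph f A).dist x y = 1 → 0 < P x y
  shift_invariant : ∀ u, u ≠ TileVertex.root → P u.shift = (P u).map TileVertex.shift

/-!
The proof rests on two comparisons between the tile graph and the space `X`, with `lam⁻¹` as the
rate of contraction.

*Geometry.* By expansion the tile of a word of length `n` has diameter `O(lam⁻ⁿ)`
(`dist_le_of_mem_tile`). A geodesic from `u` to `v` with Gromov product `(u, v)_o ≥ j + t` descends
no further than level `j + t`, so the images under `f^j` of its tiles have total diameter `O(lam⁻ᵗ)`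
(`dist_iterate_le_of_le_gromovProduct`). Conversely, if the orbits of two points in the tiles of `u`
and `v` stay close up to time `n`, then the prefixes of `u` and `v` of length `n + N` have
intersecting tiles, `N` being a constant (`exists_tile_take_inter_nonempty`): this holds at time `n`
because there are finitely many tiles of level `N`, and the Markov property together with expansion
pulls a common point back. Two vertices with intersecting prefix tiles of length `n` have Gromov
product at least `n - 1/2`. Since closeness of orbits obeys the triangle inequality, the graph is
hyperbolic. At `j = 0` the same estimates say that, for vertices of high level, a large Gromov
product is the same as tiles being close. Hence sequences converging at infinity are those whose
tiles shrink to a point of `X` and whose levels tend to infinity, and the topology of the Gromov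
compactification at the boundary can be read off in `X` (`nhds_ofBoundary_hasBasis`). That every
point of `X` occurs follows from the tiles of each level being a cover
(`exists_level_eq_mem_tile`).

*Martin boundary.* The level increases with every step and the steps have bounded length, so the
vertices that the chain can reach from `u` have tiles within `O(lam^(-|u|))` of the tile of `u`
(`IsTileWalk.exists_dist_le_of_reflTransGen`). If `k` is a Martin boundary function with `k u ≠ 0`,
then `G(u, v) ≠ 0` for all vertices `v` with `K(·, v)` near `k`, so all these `v` are confined to
that neighbourhood. A boundary function is subharmonic and equals `1` at `o`, so it is nonzero at
vertices `u` of arbitrarily high level (`exists_le_level_martinBoundary_ne_zero`). This determines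
one point of `X` at which `k` is concentrated, and the map from `k` to this point is the extension
of the identity. Vertices are isolated in the Martin compactification, because `K(·, v)` alone fails
to be harmonic at `v`; surjectivity is compactness of the set of Martin kernels.
-/

/-! ### Words and their tiles -/

namespace TileVertex

variable {X ι : Type*} {f : X → X} {A : ι → Set X}

theorem mem_tile {u : TileVertex f A} {x : X} :
    x ∈ u.tile ↔ ∀ i (h : i < u.1.length), f^[i] x ∈ A (u.1[i]) :=
  ⟨fun h i hi => h ⟨i, hi⟩, fun h i => h i i.2⟩

theorem tile_root : (root : TileVertex f A).tile = univ :=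
  eq_univ_of_forall fun _ => mem_tile.2 fun i h => by simp [root] at h

/-- The admissible word with a given list of letters. -/
def ofList (l : List ι) (h : l.IsChain (fun i j => A j ⊆ f '' A i)) : TileVertex f A := ⟨l, h⟩

theorem mem_tile_cons {a : ι} {l : List ι}
    {h : (a :: l).IsChain (fun i j => A j ⊆ f '' A i)} {x : X} :
    x ∈ (ofList (a :: l) h).tile ↔ x ∈ A a ∧ f x ∈ (ofList l h.tail).tile := by
  rw [mem_tile, mem_tile]
  constructor
  · intro H
    exact ⟨H 0 (Nat.succ_pos _), fun i hi => H (i + 1) (Nat.succ_lt_succ hi)⟩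
  · rintro ⟨h0, h1⟩ (_ | i) hi
    · exact h0
    · exact h1 i (Nat.lt_of_succ_lt_succ hi)

/-- The prefix of length `n` of a word (the whole word if it is shorter). -/
def take (n : ℕ) (u : TileVertex f A) : TileVertex f A := ⟨u.1.take n, u.2.take n⟩

/-- The word with its first `n` letters removed. -/
def drop (n : ℕ) (u : TileVertex f A) : TileVertex f A := ⟨u.1.drop n, u.2.drop n⟩

theorem level_take (n : ℕ) (u : TileVertex f A) : (u.take n).level = min n u.level :=
  List.length_take

theorem level_drop (n : ℕ) (u : TileVertex f A) : (u.drop n).level = u.level - n :=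
  List.length_drop

theorem take_of_le {n : ℕ} {u : TileVertex f A} (h : u.level ≤ n) : u.take n = u :=
  Subtype.ext (List.take_of_length_le h)

theorem take_zero (u : TileVertex f A) : u.take 0 = root := rfl

theorem tile_subset_tile_take (n : ℕ) (u : TileVertex f A) : u.tile ⊆ (u.take n).tile := by
  intro x hx
  rw [mem_tile] at hx ⊢
  intro i hi
  have hi' : i < min n u.1.length := by simpa [take] using hi
  have := hx i (lt_of_lt_of_le hi' (min_le_right _ _))
  simpa [take] using this

theorem iterate_mem_tile_drop {u : TileVertex f A} {x : X} (hx : x ∈ u.tile) (n : ℕ) :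
    f^[n] x ∈ (u.drop n).tile := by
  rw [mem_tile] at hx ⊢
  intro i hi
  have hi' : i < u.1.length - n := by simpa [drop] using hi
  have := hx (n + i) (by omega)
  rw [← Function.iterate_add_apply, add_comm i n]
  simpa [drop] using this

theorem tile_nonempty [Nonempty X] (hA : ∀ i, (A i).Nonempty) (u : TileVertex f A) :
    u.tile.Nonempty := by
  obtain ⟨l, hl⟩ := u
  change (ofList l hl).tile.Nonempty
  induction l with
  | nil => exact ⟨Classical.arbitrary X, mem_tile.2 fun i h => absurd h (Nat.not_lt_zero i)⟩
  | cons a l ih =>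
    obtain ⟨y, hy⟩ := ih hl.tail
    cases l with
    | nil =>
      obtain ⟨x, hx⟩ := hA a
      exact ⟨x, mem_tile_cons.2 ⟨hx, mem_tile.2 fun i h => absurd h (Nat.not_lt_zero i)⟩⟩
    | cons b l =>
      obtain ⟨x, hx, rfl⟩ := (List.isChain_cons_cons.1 hl).1 (mem_tile_cons.1 hy).1
      exact ⟨x, mem_tile_cons.2 ⟨hx, hy⟩⟩

/-- A point of the tile of a nonempty suffix has a preimage in the tile of the whole word. -/
theorem exists_mem_tile_iterate_eq {u : TileVertex f A} {n : ℕ} (hn : n < u.level) {y : X}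
    (hy : y ∈ (u.drop n).tile) : ∃ x ∈ u.tile, f^[n] x = y := by
  obtain ⟨l, hl⟩ := u
  change n < l.length at hn
  change ∃ x ∈ (ofList l hl).tile, f^[n] x = y
  induction n generalizing l with
  | zero => exact ⟨y, hy, rfl⟩
  | succ n ih =>
    match l, hl, hn with
    | a :: b :: l, hl, hn =>
      obtain ⟨z, hz, rfl⟩ := ih (b :: l) hl.tail hy (Nat.lt_of_succ_lt_succ hn)
      obtain ⟨x, hx, rfl⟩ := (List.isChain_cons_cons.1 hl).1 (mem_tile_cons.1 hz).1
      exact ⟨x, mem_tile_cons.2 ⟨hx, hz⟩, rfl⟩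
    | [a], hl, hn => exact absurd (Nat.lt_of_succ_lt_succ hn) (Nat.not_lt_zero _)

theorem finite_level_le [Finite ι] (n : ℕ) : {u : TileVertex f A | u.level ≤ n}.Finite :=
  (List.finite_length_le ι n).preimage Subtype.val_injective.injOn

theorem isClosed_tile [TopologicalSpace X] (hf : Continuous f) (hA : ∀ i, IsClosed (A i))
    (u : TileVertex f A) : IsClosed u.tile := by
  have : u.tile = ⋂ i : Fin u.1.length, f^[(i : ℕ)] ⁻¹' A (u.1.get i) := by
    ext x
    simp [tile]
  rw [this]
  exact isClosed_iInter fun i => (hA _).preimage (hf.iterate i)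

end TileVertex

theorem IsMarkovPartition.isClosed {X ι : Type*} [TopologicalSpace X] {f : X → X} {A : ι → Set X}
    (hA : IsMarkovPartition f A) (i : ι) : IsClosed (A i) := by
  rw [hA.closure_interior i]
  exact isClosed_closure

/-- If `f x ∈ A j`, then `x` lies in some `A i` with `A j ⊆ f (A i)`: the open set
`f⁻¹ (int A j)` accumulates at `x`, and it meets the interior of one of the finitely many sets
`A i` arbitrarily close to `x`. -/
theorem IsMarkovPartition.exists_mem_subset_image {X ι : Type*} [TopologicalSpace X] [T2Space X]
    [CompactSpace X] [Finite ι] {f : X → X} {A : ι → Set X} (hA : IsMarkovPartition f A)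
    (hf : Continuous f) (hfo : IsOpenMap f) {x : X} {j : ι} (hx : f x ∈ A j) :
    ∃ i, x ∈ A i ∧ A j ⊆ f '' A i := by
  have hx1 : x ∈ closure (f ⁻¹' interior (A j)) := by
    apply hfo.preimage_closure_subset_closure_preimage
    rwa [mem_preimage, ← hA.closure_interior j]
  have hdense : Dense (⋃ i, interior (A i)) := by
    rw [dense_iff_closure_eq, closure_iUnion_of_finite, ← hA.cover]
    exact iUnion_congr fun i => (hA.closure_interior i).symm
  have hW : IsOpen (f ⁻¹' interior (A j)) := isOpen_interior.preimage hf
  replace hx1 := closure_minimal (hdense.open_subset_closure_inter hW) isClosed_closure hx1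
  rw [inter_iUnion, closure_iUnion_of_finite, mem_iUnion] at hx1
  obtain ⟨i, hi⟩ := hx1
  refine ⟨i, ?_, ?_⟩
  · rw [hA.closure_interior i]
    exact closure_mono inter_subset_right hi
  · obtain ⟨z, hz1, hz2⟩ := closure_nonempty_iff.1 ⟨x, hi⟩
    have h1 := hA.markov i j ⟨f z, ⟨z, hz2, rfl⟩, hz1⟩
    rw [hA.closure_interior j]
    exact closure_minimal (h1.trans (image_mono interior_subset))
      ((hA.isClosed i).isCompact.image hf).isClosed

/-! ### Tiles of expanding maps -/

section Expanding

variable {X : Type*} [MetricSpace X] {f : X → X} {ξ lam : ℝ}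

theorem IsOpenExpanding.lam_pos (hf : IsOpenExpanding f ξ lam) : 0 < lam :=
  one_pos.trans hf.one_lt_lam

/-- Two points whose orbits stay `ξ`-close until they coincide are equal. -/
theorem IsOpenExpanding.eq_of_iterate_eq (hf : IsOpenExpanding f ξ lam) {x y : X} {n : ℕ}
    (hclose : ∀ j ≤ n, dist (f^[j] x) (f^[j] y) ≤ ξ) (h : f^[n] x = f^[n] y) : x = y := by
  induction n with
  | zero => exact h
  | succ n ih =>
    refine ih (fun j hj => hclose j (hj.trans n.le_succ)) ?_
    have h1 := hf.expanding _ _ (hclose n n.le_succ)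
    rw [← Function.iterate_succ_apply' f, ← Function.iterate_succ_apply' f, h, dist_self] at h1
    have h2 := hf.lam_pos
    exact dist_le_zero.1 (by nlinarith [dist_nonneg (x := f^[n] x) (y := f^[n] y)])

theorem IsOpenExpanding.tendsto_inv_pow (hf : IsOpenExpanding f ξ lam) (C : ℝ) :
    Tendsto (fun n : ℕ => C * lam⁻¹ ^ n) atTop (𝓝 0) := by
  simpa using (tendsto_pow_atTop_nhds_zero_of_lt_one (inv_nonneg.2 hf.lam_pos.le)
    (inv_lt_one_of_one_lt₀ hf.one_lt_lam)).const_mul C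

end Expanding

section ExpandingCompact

variable {X ι : Type*} [MetricSpace X] [CompactSpace X] {f : X → X} {ξ lam : ℝ} {A : ι → Set X}

open TileVertex

/-- The tiles of every level cover the space. -/
theorem exists_level_eq_mem_tile [Finite ι] (hf : IsOpenExpanding f ξ lam)
    (hA : IsMarkovPartition f A) (n : ℕ) (x : X) :
    ∃ u : TileVertex f A, u.level = n ∧ x ∈ u.tile := by
  induction n generalizing x with
  | zero => exact ⟨root, rfl, by simp [tile_root]⟩
  | succ n ih =>
    obtain ⟨⟨l, hl⟩, hln, hx⟩ := ih (f x)
    change l.length = n at hln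
    change f x ∈ (ofList l hl).tile at hx
    cases l with
    | nil =>
      obtain ⟨i, hi⟩ := mem_iUnion.1 (hA.cover.symm ▸ mem_univ x)
      exact ⟨ofList [i] (List.isChain_singleton i), congrArg Nat.succ hln,
        mem_tile_cons.2 ⟨hi, hx⟩⟩
    | cons j l =>
      obtain ⟨i, hi, hij⟩ :=
        hA.exists_mem_subset_image hf.continuous hf.isOpenMap (mem_tile_cons.1 hx).1
      exact ⟨ofList (i :: j :: l) (List.isChain_cons_cons.2 ⟨hij, hl⟩), congrArg Nat.succ hln,
        mem_tile_cons.2 ⟨hi, hx⟩⟩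

/-- Tiles of level `n` have diameter of order `lam⁻ⁿ`. -/
theorem dist_le_of_mem_tile (hf : IsOpenExpanding f ξ lam) (hmesh : ∀ i, Metric.diam (A i) < ξ)
    (u : TileVertex f A) {x y : X} (hx : x ∈ u.tile) (hy : y ∈ u.tile) :
    dist x y ≤ Metric.diam (univ : Set X) * lam⁻¹ ^ u.level := by
  obtain ⟨l, hl⟩ := u
  change x ∈ (ofList l hl).tile at hx
  change y ∈ (ofList l hl).tile at hy
  change dist x y ≤ Metric.diam (univ : Set X) * lam⁻¹ ^ l.length
  induction l generalizing x y with
  | nil =>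
    simpa using Metric.dist_le_diam_of_mem isCompact_univ.isBounded (mem_univ x) (mem_univ y)
  | cons a l ih =>
    rw [mem_tile_cons] at hx hy
    have h1 : dist x y ≤ ξ :=
      (Metric.dist_le_diam_of_mem (isCompact_univ.isBounded.subset (subset_univ _)) hx.1 hy.1).trans
        (hmesh a).le
    have h2 := (hf.expanding x y h1).trans (ih hl.tail hx.2 hy.2)
    have h3 := hf.lam_pos
    rw [List.length_cons, pow_succ, ← mul_assoc, ← div_eq_mul_inv, le_div_iff₀ h3]
    linarith

/-- The same for iterates; the natural subtraction is harmless, as the bound is then the diameter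
of the space. -/
theorem dist_iterate_le_of_mem_tile (hf : IsOpenExpanding f ξ lam)
    (hmesh : ∀ i, Metric.diam (A i) < ξ) (u : TileVertex f A) {x y : X} (hx : x ∈ u.tile)
    (hy : y ∈ u.tile) (j : ℕ) :
    dist (f^[j] x) (f^[j] y) ≤ Metric.diam (univ : Set X) * lam⁻¹ ^ (u.level - j) := by
  rw [← level_drop]
  exact dist_le_of_mem_tile hf hmesh _ (iterate_mem_tile_drop hx j) (iterate_mem_tile_drop hy j)

/-- Tiles of a fixed level that are close enough to each other meet. -/
theorem exists_pos_forall_tile_inter_nonempty [Finite ι] (hf : IsOpenExpanding f ξ lam)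
    (hA : IsMarkovPartition f A) (n : ℕ) :
    ∃ ε : ℝ, 0 < ε ∧ ∀ u v : TileVertex f A, u.level ≤ n → v.level ≤ n →
      ∀ x ∈ u.tile, ∀ y ∈ v.tile, dist x y ≤ ε → (u.tile ∩ v.tile).Nonempty := by
  have hclosed : ∀ u : TileVertex f A, IsClosed u.tile := isClosed_tile hf.continuous hA.isClosed
  have key : ∀ u v : TileVertex f A, ∀ᶠ ε in 𝓝[>] (0 : ℝ),
      ∀ x ∈ u.tile, ∀ y ∈ v.tile, dist x y ≤ ε → (u.tile ∩ v.tile).Nonempty := by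
    intro u v
    by_cases h : (u.tile ∩ v.tile).Nonempty
    · exact Eventually.of_forall fun _ _ _ _ _ _ => h
    · obtain ⟨r, hr, H⟩ := Metric.exists_pos_forall_lt_edist (hclosed u).isCompact (hclosed v)
        (disjoint_iff_inter_eq_empty.2 (not_nonempty_iff_eq_empty.1 h))
      filter_upwards [Ioo_mem_nhdsGT (show (0 : ℝ) < r from hr)] with ε hε x hx y hy hxy
      have := H x hx y hy
      rw [edist_nndist, ENNReal.coe_lt_coe, ← NNReal.coe_lt_coe, coe_nndist] at this
      linarith [hε.2]
  have hfin := finite_level_le (f := f) (A := A) n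
  have h := (hfin.eventually_all).2 fun u _ => (hfin.eventually_all).2 fun v _ => key u v
  obtain ⟨ε, h1, h2⟩ := (h.and self_mem_nhdsWithin).exists
  exact ⟨ε, h2, fun u v hu hv => h1 u hu v hv⟩

/-- Points whose orbits stay close up to time `n` lie in tiles of level about `n` that meet: at
time `n` the orbits lie in tiles of a fixed level `N` with a common point, which has a preimage
in either tile of level `n + N`, and these two preimages agree by expansion. -/
theorem exists_tile_take_inter_nonempty [Finite ι] (hf : IsOpenExpanding f ξ lam)
    (hA : IsMarkovPartition f A) (hmesh : ∀ i, Metric.diam (A i) < ξ) :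
    ∃ δ : ℝ, 0 < δ ∧ ∃ N : ℕ, ∀ (n : ℕ) (u v : TileVertex f A), n + N ≤ u.level →
      n + N ≤ v.level → ∀ x ∈ u.tile, ∀ y ∈ v.tile,
      (∀ j ≤ n, dist (f^[j] x) (f^[j] y) ≤ δ) →
      ((u.take (n + N)).tile ∩ (v.take (n + N)).tile).Nonempty := by
  have hξ := hf.xi_pos
  -- Tiles of level `N ≥ 1` have diameter at most `ξ / 3`, so that three such distances add up to
  -- at most `ξ`, where expansion applies.
  obtain ⟨N, hN, hN1⟩ := (((hf.tendsto_inv_pow (Metric.diam (univ : Set X))).eventually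
    (ge_mem_nhds (show 0 < ξ / 3 by positivity))).and (eventually_ge_atTop 1)).exists
  obtain ⟨ε, hε, H⟩ := exists_pos_forall_tile_inter_nonempty hf hA N
  refine ⟨min ε (ξ / 3), by positivity, N, fun n u v hu hv x hx y hy hxy => ?_⟩
  have hu' : (u.take (n + N)).level = n + N := by rw [level_take, min_eq_left hu]
  have hv' : (v.take (n + N)).level = n + N := by rw [level_take, min_eq_left hv]
  replace hx := tile_subset_tile_take (n + N) u hx
  replace hy := tile_subset_tile_take (n + N) v hy
  obtain ⟨p, hp1, hp2⟩ := H ((u.take (n + N)).drop n) ((v.take (n + N)).drop n)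
    (by rw [level_drop]; omega) (by rw [level_drop]; omega) _ (iterate_mem_tile_drop hx n)
    _ (iterate_mem_tile_drop hy n) ((hxy n le_rfl).trans (min_le_left _ _))
  obtain ⟨q, hq, hqp⟩ := exists_mem_tile_iterate_eq (by omega) hp1
  obtain ⟨q', hq', hqp'⟩ := exists_mem_tile_iterate_eq (by omega) hp2
  have small : ∀ (w : TileVertex f A), w.level = n + N → ∀ a ∈ w.tile, ∀ b ∈ w.tile, ∀ j ≤ n,
      dist (f^[j] a) (f^[j] b) ≤ ξ / 3 := by
    intro w hw a ha b hb j hj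
    refine (dist_iterate_le_of_mem_tile hf hmesh w ha hb j).trans (le_trans ?_ hN)
    exact mul_le_mul_of_nonneg_left (pow_le_pow_of_le_one (inv_nonneg.2 hf.lam_pos.le)
      (inv_lt_one_of_one_lt₀ hf.one_lt_lam).le (by omega)) Metric.diam_nonneg
  have hqq : q = q' := by
    refine hf.eq_of_iterate_eq (n := n) (fun j hj => ?_) (hqp.trans hqp'.symm)
    have h1 := small _ hu' q hq x hx j hj
    have h2 := (hxy j hj).trans (min_le_right _ _)
    have h3 := small _ hv' y hy q' hq' j hj
    have := dist_triangle4 (f^[j] q) (f^[j] x) (f^[j] y) (f^[j] q')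
    linarith
  exact ⟨q, hq, hqq ▸ hq'⟩

end ExpandingCompact

/-! ### Hyperbolicity of the tile graph -/

section TileGraph

open TileVertex

variable {X ι : Type*} {f : X → X} {A : ι → Set X}

theorem level_le_add_length {u v : TileVertex f A} (p : (tileGraph f A).Walk u v) :
    v.level ≤ u.level + p.length := by
  induction p with
  | nil => simp
  | cons h p ih =>
    have := h.2.1.2
    rw [SimpleGraph.Walk.length_cons]
    omega

theorem tileGraph_adj_take_succ [Nonempty X] (hA : ∀ i, (A i).Nonempty)
    {u : TileVertex f A} {n : ℕ}
    (h : n + 1 ≤ u.level) : (tileGraph f A).Adj (u.take (n + 1)) (u.take n) := by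
  have h1 : (u.take (n + 1)).level = n + 1 := by rw [level_take]; omega
  have h2 : (u.take n).level = n := by rw [level_take]; omega
  refine ⟨fun h => ?_, ⟨by omega, by omega⟩, ?_⟩
  · rw [h] at h1
    omega
  · exact (tile_nonempty hA u).mono
      (subset_inter (tile_subset_tile_take _ u) (tile_subset_tile_take _ u))

theorem exists_walk_take [Nonempty X] (hA : ∀ i, (A i).Nonempty) (u : TileVertex f A) {n d : ℕ}
    (h : n + d = u.level) : ∃ p : (tileGraph f A).Walk u (u.take n), p.length = d := by
  induction d generalizing n with
  | zero =>
    rw [take_of_le (show u.level ≤ n by omega)]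
    exact ⟨SimpleGraph.Walk.nil, rfl⟩
  | succ d ih =>
    obtain ⟨p, hp⟩ := ih (n := n + 1) (by omega)
    have hadj := tileGraph_adj_take_succ hA (show n + 1 ≤ u.level by omega)
    exact ⟨p.concat hadj, by rw [SimpleGraph.Walk.length_concat, hp]⟩

theorem tileGraph_connected [Nonempty X] (hA : ∀ i, (A i).Nonempty) :
    (tileGraph f A).Connected := by
  rw [SimpleGraph.connected_iff_exists_forall_reachable]
  exact ⟨root, fun u => (exists_walk_take hA u (zero_add _)).choose.reachable.symm⟩

theorem dist_take_le [Nonempty X] (hA : ∀ i, (A i).Nonempty) (u : TileVertex f A) {n : ℕ}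
    (h : n ≤ u.level) : (tileGraph f A).dist u (u.take n) + n ≤ u.level := by
  obtain ⟨p, hp⟩ := exists_walk_take hA u (Nat.add_sub_of_le h)
  have := SimpleGraph.dist_le p
  omega

theorem level_le_add_dist [Nonempty X] (hA : ∀ i, (A i).Nonempty) (u v : TileVertex f A) :
    v.level ≤ u.level + (tileGraph f A).dist u v := by
  obtain ⟨p, hp⟩ := (tileGraph_connected hA).exists_walk_length_eq_dist u v
  exact hp ▸ level_le_add_length p

theorem dist_root [Nonempty X] (hA : ∀ i, (A i).Nonempty) (u : TileVertex f A) :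
    (tileGraph f A).dist root u = u.level := by
  have h1 := level_le_add_dist hA root u
  have h2 := dist_take_le hA u (Nat.zero_le _)
  rw [take_zero, SimpleGraph.dist_comm] at h2
  have h3 : (root : TileVertex f A).level = 0 := rfl
  omega

theorem two_mul_gromovProduct_root [Nonempty X] (hA : ∀ i, (A i).Nonempty)
    (u v : TileVertex f A) : 2 * gromovProduct (tileGraph f A) root u v =
      u.level + v.level - (tileGraph f A).dist u v := by
  rw [gromovProduct, SimpleGraph.dist_comm (u := u), dist_root hA, dist_root hA]
  ring

theorem gromovProduct_root_comm (G : SimpleGraph (TileVertex f A)) (u v : TileVertex f A) :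
    gromovProduct G root u v = gromovProduct G root v u := by
  simp only [gromovProduct, SimpleGraph.dist_comm (u := u), SimpleGraph.dist_comm (v := v)]
  ring

theorem gromovProduct_root_le_level [Nonempty X] (hA : ∀ i, (A i).Nonempty)
    (u v : TileVertex f A) : gromovProduct (tileGraph f A) root u v ≤ u.level := by
  have h1 := two_mul_gromovProduct_root hA u v
  have h2 : (v.level : ℝ) ≤ u.level + (tileGraph f A).dist u v := by
    exact_mod_cast level_le_add_dist hA u v
  linarith

theorem gromovProduct_root_nonneg [Nonempty X] (hA : ∀ i, (A i).Nonempty)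
    (u v : TileVertex f A) : 0 ≤ gromovProduct (tileGraph f A) root u v := by
  have h1 := two_mul_gromovProduct_root hA u v
  have h2 := (tileGraph_connected hA).dist_triangle (u := u) (v := root) (w := v)
  rw [SimpleGraph.dist_comm (u := u) (v := root), dist_root hA, dist_root hA] at h2
  have h3 : ((tileGraph f A).dist u v : ℝ) ≤ u.level + v.level := by exact_mod_cast h2
  linarith

/-- Prefixes of length `n` with intersecting tiles are at distance at most one. -/
theorem le_gromovProduct_root_of_tile_take_inter [Nonempty X] (hA : ∀ i, (A i).Nonempty)
    {u v : TileVertex f A} {n : ℕ} (hu : n ≤ u.level) (hv : n ≤ v.level)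
    (h : ((u.take n).tile ∩ (v.take n).tile).Nonempty) :
    (n : ℝ) ≤ gromovProduct (tileGraph f A) root u v + 1 / 2 := by
  have hc := tileGraph_connected (f := f) hA
  have h1 : (tileGraph f A).dist (u.take n) (v.take n) ≤ 1 := by
    by_cases he : u.take n = v.take n
    · simp [he]
    · have hadj : (tileGraph f A).Adj (u.take n) (v.take n) :=
        ⟨he, by rw [level_take, level_take]; omega, h⟩
      exact (SimpleGraph.dist_eq_one_iff_adj.2 hadj).le
  have h2 := dist_take_le hA u hu
  have h3 := dist_take_le hA v hv
  have h4 := hc.dist_triangle (u := u) (v := u.take n) (w := v)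
  have h5 := hc.dist_triangle (u := u.take n) (v := v.take n) (w := v)
  rw [SimpleGraph.dist_comm (u := v)] at h3
  have h6 : 2 * n + (tileGraph f A).dist u v ≤ u.level + v.level + 1 := by omega
  have h7 : (2 * n + (tileGraph f A).dist u v : ℝ) ≤ u.level + v.level + 1 := by exact_mod_cast h6
  have h8 := two_mul_gromovProduct_root hA u v
  linarith

end TileGraph

/-- The four-point condition at one basepoint implies it, with twice the constant, at all
basepoints. -/
theorem GromovHyperbolic.of_basepoint {V : Type*} (G : SimpleGraph V) (o : V) {δ : ℝ} (hδ : 0 ≤ δ)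
    (h : ∀ x y z : V, min (gromovProduct G o x z) (gromovProduct G o z y) - δ ≤
      gromovProduct G o x y) : GromovHyperbolic G := by
  refine ⟨2 * δ, by positivity, fun x y z w => ?_⟩
  have hc : ∀ a b : V, gromovProduct G o a b = gromovProduct G o b a := fun a b => by
    simp only [gromovProduct, SimpleGraph.dist_comm (u := a), SimpleGraph.dist_comm (v := b)]
    ring
  have h' : ∀ x y z : V, gromovProduct G o x z - δ ≤ gromovProduct G o x y ∨
      gromovProduct G o z y - δ ≤ gromovProduct G o x y := by
    intro x y z
    have := h x y z
    rcases min_choice (gromovProduct G o x z) (gromovProduct G o z y) with h1 | h1 <;>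
      rw [h1] at this
    exacts [.inl this, .inr this]
  have key : gromovProduct G o x z + gromovProduct G o y w - 2 * δ ≤
        gromovProduct G o x y + gromovProduct G o z w ∨
      gromovProduct G o x w + gromovProduct G o y z - 2 * δ ≤
        gromovProduct G o x y + gromovProduct G o z w := by
    have h1 := h' x y z
    have h2 := h' x y w
    have h3 := h' z w x
    have h4 := h' z w y
    rw [hc z y] at h1
    rw [hc w y] at h2
    rw [hc z x] at h3
    rw [hc z y] at h4
    by_contra! hcon
    rcases h1 with h1 | h1 <;> rcases h2 with h2 | h2 <;> rcases h3 with h3 | h3 <;>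
      rcases h4 with h4 | h4 <;> linarith [hcon.1, hcon.2]
  simp only [gromovProduct, G.dist_comm (v := o), G.dist_comm (u := z) (v := y),
    G.dist_comm (u := w)] at key ⊢
  rcases key with key | key
  · refine (sub_le_sub_right (min_le_left _ _) _).trans ?_
    linarith
  · refine (sub_le_sub_right (min_le_right _ _) _).trans ?_
    linarith

section Metric

open TileVertex

variable {X ι : Type*} [MetricSpace X] [CompactSpace X] {f : X → X} {ξ lam : ℝ} {A : ι → Set X}

/-- Along a walk that starts at level at least `length + j + t`, the diameters of the `j`-th
images of the tiles are bounded by a geometric series that starts with `lam⁻ᵗ`. -/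
theorem dist_iterate_le_of_walk (hf : IsOpenExpanding f ξ lam)
    (hmesh : ∀ i, Metric.diam (A i) < ξ) {u v : TileVertex f A} (p : (tileGraph f A).Walk u v)
    {j t : ℕ} (h : p.length + j + t ≤ u.level) {x y : X} (hx : x ∈ u.tile) (hy : y ∈ v.tile) :
    dist (f^[j] x) (f^[j] y) ≤ Metric.diam (univ : Set X) / (1 - lam⁻¹) * lam⁻¹ ^ t *
      (1 - lam⁻¹ ^ (p.length + 1)) := by
  have hθ0 : 0 ≤ lam⁻¹ := inv_nonneg.2 hf.lam_pos.le
  have hθ1 : lam⁻¹ < 1 := inv_lt_one_of_one_lt₀ hf.one_lt_lam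
  have hstep : ∀ (w : TileVertex f A) (k : ℕ), k + j + t ≤ w.level → ∀ a ∈ w.tile, ∀ b ∈ w.tile,
      dist (f^[j] a) (f^[j] b) ≤ Metric.diam (univ : Set X) / (1 - lam⁻¹) * lam⁻¹ ^ t *
        (lam⁻¹ ^ k - lam⁻¹ ^ (k + 1)) := by
    intro w k hk a ha b hb
    refine (dist_iterate_le_of_mem_tile hf hmesh w ha hb j).trans ?_
    refine (mul_le_mul_of_nonneg_left (pow_le_pow_of_le_one hθ0 hθ1.le
      (show t + k ≤ w.level - j by omega)) Metric.diam_nonneg).trans_eq ?_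
    have h1 := div_mul_cancel₀ (Metric.diam (univ : Set X)) (show 1 - lam⁻¹ ≠ 0 by linarith)
    nth_rewrite 1 [← h1]
    ring
  induction p generalizing x with
  | nil => simpa using hstep _ 0 (by simpa using h) x hx y hy
  | cons hadj p ih =>
    rw [SimpleGraph.Walk.length_cons] at h ⊢
    obtain ⟨z, hz1, hz2⟩ := hadj.2.2
    have h1 := ih (by have := hadj.2.1.1; omega) hz2 hy
    have h2 := hstep _ (p.length + 1) (by omega) x hx z hz1
    calc dist (f^[j] x) (f^[j] y) ≤ dist (f^[j] x) (f^[j] z) + dist (f^[j] z) (f^[j] y) :=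
          dist_triangle _ _ _
      _ ≤ _ := (add_le_add h2 h1).trans_eq (by ring)

/-- If the Gromov product of `u` and `v` is at least `j + t`, then the images under `f^j` of
points of their tiles are within `O(lam⁻ᵗ)`: a geodesic can be cut so that both halves,
followed from `u` and `v`, satisfy the hypothesis of `dist_iterate_le_of_walk`. -/
theorem dist_iterate_le_of_le_gromovProduct [Nonempty X] (hf : IsOpenExpanding f ξ lam)
    (hA : ∀ i, (A i).Nonempty) (hmesh : ∀ i, Metric.diam (A i) < ξ) {u v : TileVertex f A}
    {j t : ℕ} (h : ((j + t : ℕ) : ℝ) ≤ gromovProduct (tileGraph f A) root u v) {x y : X}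
    (hx : x ∈ u.tile) (hy : y ∈ v.tile) :
    dist (f^[j] x) (f^[j] y) ≤
      2 * (Metric.diam (univ : Set X) / (1 - lam⁻¹)) * lam⁻¹ ^ t := by
  have hθ0 : 0 ≤ lam⁻¹ := inv_nonneg.2 hf.lam_pos.le
  have hθ1 : lam⁻¹ < 1 := inv_lt_one_of_one_lt₀ hf.one_lt_lam
  have hbound : ∀ {u v : TileVertex f A} (p : (tileGraph f A).Walk u v),
      p.length + j + t ≤ u.level → ∀ x ∈ u.tile, ∀ y ∈ v.tile,
      dist (f^[j] x) (f^[j] y) ≤ Metric.diam (univ : Set X) / (1 - lam⁻¹) * lam⁻¹ ^ t := by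
    intro u v p hp x hx y hy
    refine (dist_iterate_le_of_walk hf hmesh p hp hx hy).trans ?_
    refine mul_le_of_le_one_right (mul_nonneg (div_nonneg Metric.diam_nonneg (by linarith))
      (by positivity)) ?_
    have : 0 ≤ lam⁻¹ ^ (p.length + 1) := by positivity
    linarith
  have h1 : 2 * (j + t) + (tileGraph f A).dist u v ≤ u.level + v.level := by
    have h2 := two_mul_gromovProduct_root hA u v
    have : (2 * ((j + t : ℕ) : ℝ) + (tileGraph f A).dist u v) ≤ u.level + v.level := by linarith
    exact_mod_cast this
  have h3 : j + t ≤ u.level := by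
    exact_mod_cast h.trans (gromovProduct_root_le_level hA u v)
  have h4 : j + t ≤ v.level := by
    rw [gromovProduct_root_comm] at h
    exact_mod_cast h.trans (gromovProduct_root_le_level hA v u)
  obtain ⟨p, hp⟩ := (tileGraph_connected (f := f) hA).exists_walk_length_eq_dist u v
  obtain ⟨z, hz⟩ := tile_nonempty hA (p.getVert (u.level - (j + t)))
  have h5 := hbound (p.take (u.level - (j + t)))
    (by rw [SimpleGraph.Walk.take_length]; omega) x hx z hz
  have h6 := hbound (p.drop (u.level - (j + t))).reverse
    (by rw [SimpleGraph.Walk.length_reverse, SimpleGraph.Walk.drop_length]; omega) y hy z hz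
  rw [dist_comm] at h6
  have := dist_triangle (f^[j] x) (f^[j] z) (f^[j] y)
  linarith

theorem tileGraph_gromovHyperbolic [Nonempty X] [Finite ι] (hf : IsOpenExpanding f ξ lam)
    (hA : IsMarkovPartition f A) (hmesh : ∀ i, Metric.diam (A i) < ξ) :
    GromovHyperbolic (tileGraph f A) := by
  obtain ⟨δ, hδ, N, H⟩ := exists_tile_take_inter_nonempty hf hA hmesh
  obtain ⟨T, hT⟩ := ((hf.tendsto_inv_pow
    (2 * (Metric.diam (univ : Set X) / (1 - lam⁻¹)))).eventually (ge_mem_nhds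
      (show 0 < δ / 2 by positivity))).exists
  -- `T` makes the orbits close enough, `N` makes the levels at least `n + N`, and `2` covers the
  -- integer part `n` of `m - (T + N)` and the `1/2` in the bound for intersecting prefix tiles.
  refine GromovHyperbolic.of_basepoint _ root (δ := T + N + 2) (by positivity) fun u v w => ?_
  set m := min (gromovProduct (tileGraph f A) root u w) (gromovProduct (tileGraph f A) root w v)
  rcases lt_or_ge m (T + N) with hm | hm
  · linarith [gromovProduct_root_nonneg hA.nonempty u v]
  obtain ⟨n, hn1, hn2⟩ : ∃ n : ℕ, (n : ℝ) ≤ m - (T + N) ∧ m - (T + N) < n + 1 :=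
    ⟨_, Nat.floor_le (by linarith), Nat.lt_floor_add_one _⟩
  have huw : m ≤ gromovProduct (tileGraph f A) root u w := min_le_left _ _
  have hwv : m ≤ gromovProduct (tileGraph f A) root w v := min_le_right _ _
  have hu := huw.trans (gromovProduct_root_le_level hA.nonempty u w)
  have hv := hwv.trans
    ((gromovProduct_root_comm _ w v).trans_le (gromovProduct_root_le_level hA.nonempty v w))
  have hu' : n + N ≤ u.level := by
    have : (n + N : ℝ) ≤ u.level := by linarith [(Nat.cast_nonneg T : (0 : ℝ) ≤ T)]
    exact_mod_cast this
  have hv' : n + N ≤ v.level := by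
    have : (n + N : ℝ) ≤ v.level := by linarith [(Nat.cast_nonneg T : (0 : ℝ) ≤ T)]
    exact_mod_cast this
  obtain ⟨x, hx⟩ := tile_nonempty hA.nonempty u
  obtain ⟨y, hy⟩ := tile_nonempty hA.nonempty v
  obtain ⟨z, hz⟩ := tile_nonempty hA.nonempty w
  have hmeet := H n u v hu' hv' x hx y hy fun j hj => by
    have hj' : ((j + T : ℕ) : ℝ) ≤ m := by
      have : (j : ℝ) ≤ n := by exact_mod_cast hj
      push_cast
      linarith [(Nat.cast_nonneg N : (0 : ℝ) ≤ N)]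
    have h1 := dist_iterate_le_of_le_gromovProduct hf hA.nonempty hmesh (hj'.trans huw) hx hz
    have h2 := dist_iterate_le_of_le_gromovProduct hf hA.nonempty hmesh (hj'.trans hwv) hz hy
    have := dist_triangle (f^[j] x) (f^[j] z) (f^[j] y)
    linarith
  have := le_gromovProduct_root_of_tile_take_inter hA.nonempty hu' hv' hmeet
  push_cast at this
  linarith

/-- Tiles of vertices with a large Gromov product are close. -/
theorem exists_dist_lt_of_le_gromovProduct [Nonempty X] (hf : IsOpenExpanding f ξ lam)
    (hA : ∀ i, (A i).Nonempty) (hmesh : ∀ i, Metric.diam (A i) < ξ) {ε : ℝ} (hε : 0 < ε) :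
    ∃ r : ℝ, ∀ u v : TileVertex f A, r ≤ gromovProduct (tileGraph f A) root u v →
      ∀ x ∈ u.tile, ∀ y ∈ v.tile, dist x y < ε := by
  obtain ⟨t, ht⟩ := ((hf.tendsto_inv_pow
    (2 * (Metric.diam (univ : Set X) / (1 - lam⁻¹)))).eventually (gt_mem_nhds hε)).exists
  refine ⟨t, fun u v h x hx y hy => ?_⟩
  exact (dist_iterate_le_of_le_gromovProduct hf hA hmesh (j := 0) (t := t)
    (by simpa using h) hx hy).trans_lt ht

/-- Vertices of high level with close tiles have a large Gromov product. -/
theorem exists_le_gromovProduct_of_dist_le [Nonempty X] [Finite ι] (hf : IsOpenExpanding f ξ lam)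
    (hA : IsMarkovPartition f A) (r : ℝ) :
    ∃ ε : ℝ, 0 < ε ∧ ∃ n : ℕ, ∀ u v : TileVertex f A, n ≤ u.level → n ≤ v.level →
      ∀ x ∈ u.tile, ∀ y ∈ v.tile, dist x y ≤ ε → r ≤ gromovProduct (tileGraph f A) root u v := by
  obtain ⟨n, hn⟩ := exists_nat_ge (r + 1)
  obtain ⟨ε, hε, H⟩ := exists_pos_forall_tile_inter_nonempty hf hA n
  refine ⟨ε, hε, n, fun u v hu hv x hx y hy hxy => ?_⟩
  have := le_gromovProduct_root_of_tile_take_inter hA.nonempty hu hv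
    (H _ _ (by rw [level_take]; omega) (by rw [level_take]; omega) x
      (tile_subset_tile_take n u hx) y (tile_subset_tile_take n v hy) hxy)
  linarith

end Metric

/-! ### The Gromov boundary of the tile graph -/

section Boundary

open TileVertex

variable {X ι : Type*} {f : X → X} {A : ι → Set X}

theorem ConvergesAtInfinity.eventually_le_level [Nonempty X] (hA : ∀ i, (A i).Nonempty)
    {s : ℕ → TileVertex f A} (hs : ConvergesAtInfinity (tileGraph f A) root s) (n : ℕ) :
    ∀ᶠ i in atTop, n ≤ (s i).level := by
  obtain ⟨N, hN⟩ := eventually_atTop_prod_self.1 (hs.eventually_ge_atTop (n : ℝ))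
  filter_upwards [eventually_ge_atTop N] with i hi
  exact_mod_cast (hN i i hi hi).trans (gromovProduct_root_le_level hA _ _)

variable [MetricSpace X]

/-- The tiles of the vertices `s n` shrink to the point `x`. -/
def TilesShrinkTo (s : ℕ → TileVertex f A) (x : X) : Prop :=
  ∀ ε > 0, ∀ᶠ n in atTop, ∀ y ∈ (s n).tile, dist y x < ε

theorem TilesShrinkTo.eq [Nonempty X] (hA : ∀ i, (A i).Nonempty) {s : ℕ → TileVertex f A} {x y : X}
    (hx : TilesShrinkTo s x) (hy : TilesShrinkTo s y) : x = y := by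
  refine eq_of_forall_dist_le fun ε hε => ?_
  obtain ⟨n, h1, h2⟩ := ((hx (ε / 2) (half_pos hε)).and (hy (ε / 2) (half_pos hε))).exists
  obtain ⟨z, hz⟩ := tile_nonempty hA (s n)
  have := dist_triangle_left x y z
  linarith [h1 z hz, h2 z hz]

variable {Ψ : GromovBoundary (tileGraph f A) root → X}

/-- The points of the compactification that are close to `x`, as measured in `X` by a map `Ψ` on
the boundary: the vertices of level at least `n` with tile in the `ε`-ball about `x`, and the
boundary points that `Ψ` maps into this ball. -/
def tileNhd (Ψ : GromovBoundary (tileGraph f A) root → X) (x : X) (ε : ℝ) (n : ℕ) :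
    Set (GromovCompactification (tileGraph f A) root) :=
  {p | Sum.elim (fun v => n ≤ v.level ∧ ∀ y ∈ v.tile, dist y x < ε) (fun ζ => dist (Ψ ζ) x < ε) p}

open GromovCompactification

theorem ofVertex_mem_tileNhd {x : X} {ε : ℝ} {n : ℕ} {v : TileVertex f A} :
    ofVertex v ∈ tileNhd Ψ x ε n ↔ n ≤ v.level ∧ ∀ y ∈ v.tile, dist y x < ε := Iff.rfl

theorem ofBoundary_mem_tileNhd {x : X} {ε : ℝ} {n : ℕ}
    {ζ : GromovBoundary (tileGraph f A) root} :
    ofBoundary ζ ∈ tileNhd Ψ x ε n ↔ dist (Ψ ζ) x < ε := Iff.rfl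

theorem tileNhd_subset {x y : X} {ε δ : ℝ} (n : ℕ) (h : δ + dist x y ≤ ε) :
    tileNhd Ψ x δ n ⊆ tileNhd Ψ y ε n := by
  rintro (v | ζ) hp
  · exact ⟨hp.1, fun z hz => by linarith [hp.2 z hz, dist_triangle z x y]⟩
  · have hp' : dist (Ψ ζ) x < δ := hp
    exact (by linarith [dist_triangle (Ψ ζ) x y] : dist (Ψ ζ) y < ε)

variable [CompactSpace X] {ξ lam : ℝ}

theorem ConvergesAtInfinity.exists_tilesShrinkTo [Nonempty X] (hf : IsOpenExpanding f ξ lam)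
    (hA : ∀ i, (A i).Nonempty) (hmesh : ∀ i, Metric.diam (A i) < ξ)
    {s : ℕ → TileVertex f A} (hs : ConvergesAtInfinity (tileGraph f A) root s) :
    ∃ x, TilesShrinkTo s x := by
  choose z hz using tile_nonempty (f := f) hA
  have key : ∀ ε > 0, ∃ N, ∀ i ≥ N, ∀ j ≥ N, ∀ x ∈ (s i).tile, ∀ y ∈ (s j).tile, dist x y < ε := by
    intro ε hε
    obtain ⟨r, hr⟩ := exists_dist_lt_of_le_gromovProduct hf hA hmesh hε
    obtain ⟨N, hN⟩ := eventually_atTop_prod_self.1 (hs.eventually_ge_atTop r)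
    exact ⟨N, fun i hi j hj => hr _ _ (hN i j hi hj)⟩
  have hc : CauchySeq (fun n => z (s n)) := Metric.cauchySeq_iff.2 fun ε hε => by
    obtain ⟨N, hN⟩ := key ε hε
    exact ⟨N, fun i hi j hj => hN i hi j hj _ (hz _) _ (hz _)⟩
  obtain ⟨x, hx⟩ := cauchySeq_tendsto_of_complete hc
  refine ⟨x, fun ε hε => ?_⟩
  obtain ⟨N, hN⟩ := key (ε / 2) (half_pos hε)
  filter_upwards [eventually_ge_atTop N] with i hi y hy
  obtain ⟨j, hj, hj'⟩ := ((eventually_ge_atTop N).and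
    (Metric.tendsto_nhds.1 hx (ε / 2) (half_pos hε))).exists
  have := dist_triangle y (z (s j)) x
  have := hN i hi j hj y hy _ (hz _)
  linarith

/-- The natural map from the Gromov boundary to `X`. -/
theorem exists_boundaryPoint [Nonempty X] (hf : IsOpenExpanding f ξ lam)
    (hA : ∀ i, (A i).Nonempty) (hmesh : ∀ i, Metric.diam (A i) < ξ) :
    ∃ Ψ : GromovBoundary (tileGraph f A) root → X,
      ∀ s hs, TilesShrinkTo s (Ψ (Quot.mk _ ⟨s, hs⟩)) := by
  choose x hx using fun s : {s // ConvergesAtInfinity (tileGraph f A) root s} =>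
    s.2.exists_tilesShrinkTo hf hA hmesh
  refine ⟨Quot.lift x fun s t hst => ?_, fun s hs => hx ⟨s, hs⟩⟩
  refine eq_of_forall_dist_le fun ε hε => ?_
  obtain ⟨r, hr⟩ := exists_dist_lt_of_le_gromovProduct hf hA hmesh (ε := ε / 3) (by positivity)
  obtain ⟨n, ⟨h1, h2⟩, h3⟩ := (((hx s (ε / 3) (by positivity)).and
    (hx t (ε / 3) (by positivity))).and (hst.eventually_ge_atTop r)).exists
  obtain ⟨y, hy⟩ := tile_nonempty hA (s.1 n)
  obtain ⟨z, hz⟩ := tile_nonempty hA (t.1 n)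
  have h4 := hr _ _ h3 y hy z hz
  have h5 := h1 y hy
  have h6 := h2 z hz
  have := dist_triangle4 (x s) y z (x t)
  rw [dist_comm (x s) y] at this
  linarith

/-- The Gromov products of `s i` with vertices close to the limit `x` of the tiles are large, with
bounds that do not depend on `s` and `x`. -/
theorem eventually_le_gromovProduct_of_tilesShrinkTo [Nonempty X] [Finite ι]
    (hf : IsOpenExpanding f ξ lam) (hA : IsMarkovPartition f A) (r : ℝ) :
    ∃ ε : ℝ, 0 < ε ∧ ∃ n : ℕ, ∀ (s : ℕ → TileVertex f A) (x : X), TilesShrinkTo s x →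
      (∀ m, ∀ᶠ i in atTop, m ≤ (s i).level) → ∀ᶠ i in atTop, ∀ v : TileVertex f A, n ≤ v.level →
      (∀ y ∈ v.tile, dist y x < ε) → r ≤ gromovProduct (tileGraph f A) root (s i) v := by
  obtain ⟨ε, hε, n, H⟩ := exists_le_gromovProduct_of_dist_le hf hA r
  refine ⟨ε / 2, half_pos hε, n, fun s x hs hlev => ?_⟩
  filter_upwards [hs (ε / 2) (half_pos hε), hlev n] with i hi hn v hv hvx
  obtain ⟨y, hy⟩ := tile_nonempty hA.nonempty (s i)
  obtain ⟨z, hz⟩ := tile_nonempty hA.nonempty v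
  refine H _ _ hn hv y hy z hz ?_
  have := dist_triangle_right y z x
  linarith [hi y hy, hvx z hz]

/-- Sequences whose levels tend to infinity and whose tiles shrink to the same point have Gromov
products tending to infinity. -/
theorem tendsto_gromovProduct_of_tilesShrinkTo [Nonempty X] [Finite ι]
    (hf : IsOpenExpanding f ξ lam) (hA : IsMarkovPartition f A) {s t : ℕ → TileVertex f A} {x : X}
    (hs : TilesShrinkTo s x) (ht : TilesShrinkTo t x) (hsl : ∀ m, ∀ᶠ i in atTop, m ≤ (s i).level)
    (htl : ∀ m, ∀ᶠ i in atTop, m ≤ (t i).level) :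
    Tendsto (fun p : ℕ × ℕ => gromovProduct (tileGraph f A) root (s p.1) (t p.2)) atTop atTop := by
  refine tendsto_atTop.2 fun r => ?_
  obtain ⟨ε, hε, n, H⟩ := eventually_le_gromovProduct_of_tilesShrinkTo hf hA r
  rw [← prod_atTop_atTop_eq]
  filter_upwards [(H s x hs hsl).prod_mk ((htl n).and (ht ε hε))] with p hp
  exact hp.1 _ hp.2.1 hp.2.2

theorem boundaryPoint_injective [Nonempty X] [Finite ι] (hf : IsOpenExpanding f ξ lam)
    (hA : IsMarkovPartition f A) (hΨ : ∀ s hs, TilesShrinkTo s (Ψ (Quot.mk _ ⟨s, hs⟩))) :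
    Function.Injective Ψ := by
  intro ζ η h
  induction ζ using Quot.ind with | _ s
  induction η using Quot.ind with | _ t
  have h1 := hΨ s.1 s.2
  have h2 := hΨ t.1 t.2
  rw [← h] at h2
  have h3 := tendsto_gromovProduct_of_tilesShrinkTo hf hA h1 h2
    (s.2.eventually_le_level hA.nonempty) (t.2.eventually_le_level hA.nonempty)
  refine Quot.sound (tendsto_atTop.2 fun r => ?_)
  obtain ⟨N, hN⟩ := eventually_atTop_prod_self.1 (h3.eventually_ge_atTop r)
  exact eventually_atTop.2 ⟨N, fun n hn => hN n n hn hn⟩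

/-- Tiles that contain `x` and whose levels tend to infinity shrink to `x`. -/
theorem tilesShrinkTo_of_mem (hf : IsOpenExpanding f ξ lam)
    (hmesh : ∀ i, Metric.diam (A i) < ξ) {s : ℕ → TileVertex f A} {x : X}
    (hs : ∀ n, (s n).level = n ∧ x ∈ (s n).tile) : TilesShrinkTo s x := by
  intro ε hε
  filter_upwards [(hf.tendsto_inv_pow (Metric.diam (univ : Set X))).eventually
    (gt_mem_nhds hε)] with n hn y hy
  refine (dist_le_of_mem_tile hf hmesh (s n) hy (hs n).2).trans_lt ?_
  rwa [(hs n).1]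

theorem boundaryPoint_surjective [Nonempty X] [Finite ι] (hf : IsOpenExpanding f ξ lam)
    (hA : IsMarkovPartition f A) (hmesh : ∀ i, Metric.diam (A i) < ξ)
    (hΨ : ∀ s hs, TilesShrinkTo s (Ψ (Quot.mk _ ⟨s, hs⟩))) : Function.Surjective Ψ := by
  intro x
  choose s hs using fun n => exists_level_eq_mem_tile hf hA n x
  have h1 := tilesShrinkTo_of_mem hf hmesh hs
  have h2 : ∀ m, ∀ᶠ i in atTop, m ≤ (s i).level := fun m => by
    filter_upwards [eventually_ge_atTop m] with i hi
    rwa [(hs i).1]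
  have h3 := tendsto_gromovProduct_of_tilesShrinkTo hf hA h1 h1 h2 h2
  exact ⟨Quot.mk _ ⟨s, h3⟩, (hΨ s h3).eq hA.nonempty h1⟩

theorem exists_product_subset_tileNhd [Nonempty X] (hf : IsOpenExpanding f ξ lam)
    (hA : ∀ i, (A i).Nonempty) (hmesh : ∀ i, Metric.diam (A i) < ξ)
    (hΨ : ∀ s hs, TilesShrinkTo s (Ψ (Quot.mk _ ⟨s, hs⟩))) {ε : ℝ} (hε : 0 < ε) (n : ℕ) :
    ∃ r : ℝ, ∀ ζ, {p | (r : EReal) ≤ product (ofBoundary ζ) p} ⊆ tileNhd Ψ (Ψ ζ) ε n := by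
  obtain ⟨r, hr⟩ := exists_dist_lt_of_le_gromovProduct hf hA hmesh (ε := ε / 3) (by positivity)
  refine ⟨max r n + 1, ?_⟩
  rintro ⟨s, hs⟩ p hp
  have hev : ∀ t, Represents t p → ∀ᶠ k : ℕ × ℕ in atTop,
      max r n < gromovProduct (tileGraph f A) root (s k.1) (t k.2) ∧
        ∀ y ∈ (s k.1).tile, dist y (Ψ (Quot.mk _ ⟨s, hs⟩)) < ε / 3 := by
    intro t ht
    have h1 : product (ofBoundary (Quot.mk _ ⟨s, hs⟩)) p ≤ liminf (fun k : ℕ × ℕ =>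
        ((gromovProduct (tileGraph f A) root (s k.1) (t k.2) : ℝ) : EReal)) atTop :=
      iInf₂_le_of_le s t (iInf₂_le_of_le ⟨hs, rfl⟩ ht le_rfl)
    have h2 := eventually_lt_of_lt_liminf (lt_of_lt_of_le
      (EReal.coe_lt_coe_iff.2 (lt_add_one (max r n))) (le_trans hp h1))
    have h3 := (prod_atTop_atTop_eq (α := ℕ) (β := ℕ) ▸ tendsto_fst).eventually
      (hΨ s hs (ε / 3) (by positivity))
    filter_upwards [h2, h3] with k h4 h5
    exact ⟨EReal.coe_lt_coe_iff.1 h4, h5⟩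
  rcases p with v | ⟨t, ht⟩
  · obtain ⟨k, h1, h2⟩ := (hev (fun _ => v) fun _ => rfl).exists
    have h3 := gromovProduct_root_le_level hA v (s k.1)
    rw [gromovProduct_root_comm] at h3
    refine ⟨?_, fun y hy => ?_⟩
    · exact_mod_cast (le_max_right r n).trans (h1.le.trans h3)
    · obtain ⟨z, hz⟩ := tile_nonempty hA (s k.1)
      have h4 := hr _ _ ((le_max_left r n).trans h1.le) z hz y hy
      have h5 := h2 z hz
      have := dist_triangle_left y (Ψ (Quot.mk _ ⟨s, hs⟩)) z
      linarith
  · have h3 := (prod_atTop_atTop_eq (α := ℕ) (β := ℕ) ▸ tendsto_snd).eventually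
      (hΨ t ht (ε / 3) (by positivity))
    obtain ⟨k, ⟨h1, h2⟩, h3⟩ := ((hev t ⟨ht, rfl⟩).and h3).exists
    obtain ⟨z, hz⟩ := tile_nonempty hA (s k.1)
    obtain ⟨y, hy⟩ := tile_nonempty hA (t k.2)
    have h4 := hr _ _ ((le_max_left r n).trans h1.le) z hz y hy
    have h5 := h2 z hz
    have h6 := h3 y hy
    have := dist_triangle4 (Ψ (Quot.mk _ ⟨t, ht⟩)) y z (Ψ (Quot.mk _ ⟨s, hs⟩))
    rw [dist_comm _ y, dist_comm y z] at this
    exact (by linarith : dist (Ψ (Quot.mk _ ⟨t, ht⟩)) (Ψ (Quot.mk _ ⟨s, hs⟩)) < ε)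

theorem exists_tileNhd_subset_product [Nonempty X] [Finite ι] (hf : IsOpenExpanding f ξ lam)
    (hA : IsMarkovPartition f A) (hΨ : ∀ s hs, TilesShrinkTo s (Ψ (Quot.mk _ ⟨s, hs⟩))) (r : ℝ) :
    ∃ ε : ℝ, 0 < ε ∧ ∃ n : ℕ, ∀ ζ, tileNhd Ψ (Ψ ζ) ε n ⊆
      {p | (r : EReal) ≤ product (ofBoundary ζ) p} := by
  obtain ⟨ε, hε, n, H⟩ := eventually_le_gromovProduct_of_tilesShrinkTo hf hA r
  refine ⟨ε / 2, half_pos hε, n, fun ζ p hp => ?_⟩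
  rw [mem_ofPred_eq, product]
  refine le_iInf fun s => le_iInf fun t => le_iInf fun hs => le_iInf fun ht => ?_
  refine le_liminf_of_le (by isBoundedDefault) ?_
  obtain ⟨hs, rfl⟩ := hs
  have h1 := H s _ (hΨ s hs) (hs.eventually_le_level hA.nonempty)
  have h2 : ∀ᶠ j in atTop, n ≤ (t j).level ∧
      ∀ y ∈ (t j).tile, dist y (Ψ (Quot.mk _ ⟨s, hs⟩)) < ε := by
    rcases p with v | ζ
    · refine Eventually.of_forall fun j => ?_
      rw [show t j = v from ht j]
      exact ⟨hp.1, fun y hy => (hp.2 y hy).trans (half_lt_self hε)⟩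
    · obtain ⟨ht, rfl⟩ := ht
      filter_upwards [ht.eventually_le_level hA.nonempty n, hΨ t ht (ε / 2) (half_pos hε)]
        with j hj1 hj2
      have hp' : dist (Ψ (Quot.mk _ ⟨t, ht⟩)) (Ψ (Quot.mk _ ⟨s, hs⟩)) < ε / 2 := hp
      refine ⟨hj1, fun y hy => ?_⟩
      have := dist_triangle y (Ψ (Quot.mk _ ⟨t, ht⟩)) (Ψ (Quot.mk _ ⟨s, hs⟩))
      linarith [hj2 y hy]
  rw [← prod_atTop_atTop_eq]
  filter_upwards [h1.prod_mk h2] with k hk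
  exact EReal.coe_le_coe_iff.2 (hk.1 _ hk.2.1 hk.2.2)

/-- Near the boundary, the topology of the compactification is the one read off in `X`. -/
theorem nhds_ofBoundary_hasBasis [Nonempty X] [Finite ι] (hf : IsOpenExpanding f ξ lam)
    (hA : IsMarkovPartition f A) (hmesh : ∀ i, Metric.diam (A i) < ξ)
    (hΨ : ∀ s hs, TilesShrinkTo s (Ψ (Quot.mk _ ⟨s, hs⟩)))
    (ζ : GromovBoundary (tileGraph f A) root) :
    (𝓝 (ofBoundary ζ)).HasBasis (fun p : ℝ × ℕ => 0 < p.1)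
      fun p => tileNhd Ψ (Ψ ζ) p.1 p.2 := by
  refine ⟨fun U => ⟨fun hU => ?_, ?_⟩⟩
  · obtain ⟨O, hOU, hO, hζ⟩ := mem_nhds_iff.1 hU
    obtain ⟨r, hr⟩ := hO ζ hζ
    obtain ⟨ε, hε, n, H⟩ := exists_tileNhd_subset_product hf hA hΨ r
    exact ⟨(ε, n), hε, (H ζ).trans (hr.trans hOU)⟩
  · rintro ⟨⟨ε, n⟩, hε, hU⟩
    refine mem_of_superset (IsOpen.mem_nhds ?_ ?_) hU
    · intro η hη
      have hη' : dist (Ψ η) (Ψ ζ) < ε := hη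
      obtain ⟨r, hr⟩ := exists_product_subset_tileNhd hf hA.nonempty hmesh hΨ
        (sub_pos.2 hη') n
      exact ⟨r, (hr η).trans (tileNhd_subset n (by linarith))⟩
    · exact ofBoundary_mem_tileNhd.2 ((dist_self _).trans_lt hε)

theorem boundaryPoint_isInducing [Nonempty X] [Finite ι] (hf : IsOpenExpanding f ξ lam)
    (hA : IsMarkovPartition f A) (hmesh : ∀ i, Metric.diam (A i) < ξ)
    (hΨ : ∀ s hs, TilesShrinkTo s (Ψ (Quot.mk _ ⟨s, hs⟩))) : IsInducing Ψ := by
  refine isInducing_iff_nhds.2 fun ζ => ?_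
  rw [nhds_induced]
  refine ((nhds_ofBoundary_hasBasis hf hA hmesh hΨ ζ).comap _).ext
    (Metric.nhds_basis_ball.comap Ψ) ?_ ?_
  · rintro ⟨ε, n⟩ hε
    exact ⟨ε, hε, fun η hη => hη⟩
  · intro ε hε
    exact ⟨(ε, 0), hε, fun η hη => hη⟩

theorem tendsto_hausdorffEDist_tile [Nonempty X] [Finite ι] (hf : IsOpenExpanding f ξ lam)
    (hA : IsMarkovPartition f A) (hmesh : ∀ i, Metric.diam (A i) < ξ)
    (hΨ : ∀ s hs, TilesShrinkTo s (Ψ (Quot.mk _ ⟨s, hs⟩)))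
    {ζ : GromovBoundary (tileGraph f A) root} {s : ℕ → TileVertex f A}
    (hs : Tendsto (fun n => ofVertex (s n)) atTop (𝓝 (ofBoundary ζ))) :
    Tendsto (fun n => Metric.hausdorffEDist (s n).tile {Ψ ζ}) atTop (𝓝 0) := by
  refine ENNReal.tendsto_nhds_zero.2 fun ε hε => ?_
  obtain ⟨δ, hδ, hδε⟩ := ENNReal.lt_iff_exists_real_btwn.1 hε
  have hδ0 : 0 < δ := ENNReal.ofReal_pos.1 hδε.1
  filter_upwards [hs.eventually ((nhds_ofBoundary_hasBasis hf hA hmesh hΨ ζ).mem_of_mem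
    (i := (δ, 0)) hδ0)] with n hn
  have h1 : ∀ y ∈ (s n).tile, edist y (Ψ ζ) ≤ ε := fun y hy => by
    rw [edist_dist]
    exact (ENNReal.ofReal_le_ofReal (hn.2 y hy).le).trans hδε.2.le
  refine Metric.hausdorffEDist_le_of_mem_edist (fun y hy => ⟨Ψ ζ, rfl, h1 y hy⟩) ?_
  rintro _ rfl
  obtain ⟨y, hy⟩ := tile_nonempty hA.nonempty (s n)
  exact ⟨y, hy, edist_comm y (Ψ ζ) ▸ h1 y hy⟩

end Boundary

/-! ### Markov chains with increasing level and their Martin boundary -/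

section Markov

variable {V : Type*} {P : V → PMF V}

theorem stepN_add (m n : ℕ) (x : V) : stepN P (m + n) x = (stepN P m x).bind (stepN P n) := by
  induction m generalizing x with
  | zero => rw [zero_add, stepN, PMF.pure_bind]
  | succ m ih =>
    rw [Nat.succ_add, stepN, stepN, PMF.bind_bind]
    exact congrArg _ (funext ih)

theorem stepN_one (x : V) : stepN P 1 x = P x := PMF.bind_pure _

theorem stepN_mul_stepN_le (m n : ℕ) (x y z : V) :
    stepN P m x y * stepN P n y z ≤ stepN P (m + n) x z := by
  rw [stepN_add, PMF.bind_apply]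
  exact ENNReal.le_tsum (f := fun y => stepN P m x y * stepN P n y z) y

theorem reflTransGen_of_stepN_ne_zero {n : ℕ} {x y : V} (h : stepN P n x y ≠ 0) :
    Relation.ReflTransGen (fun a b => P a b ≠ 0) x y := by
  induction n generalizing x with
  | zero =>
    rw [stepN, PMF.pure_apply] at h
    rw [show y = x by by_contra hxy; simp [hxy] at h]
  | succ n ih =>
    have h' : y ∈ (stepN P (n + 1) x).support := h
    rw [stepN, PMF.mem_support_bind_iff] at h'
    obtain ⟨z, hz, hzy⟩ := h'
    exact .head hz (ih hzy)

theorem reflTransGen_of_green_ne_zero {x y : V} (h : green P x y ≠ 0) :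
    Relation.ReflTransGen (fun a b => P a b ≠ 0) x y := by
  obtain ⟨n, hn⟩ := not_forall.1 (mt ENNReal.tsum_eq_zero.2 h)
  exact reflTransGen_of_stepN_ne_zero hn

theorem add_le_level_of_stepN_ne_zero {l : V → ℕ} (hl : ∀ x y, P x y ≠ 0 → l x < l y) {n : ℕ}
    {x y : V} (h : stepN P n x y ≠ 0) : l x + n ≤ l y := by
  induction n generalizing x with
  | zero =>
    rw [stepN, PMF.pure_apply] at h
    rw [show y = x by by_contra hxy; simp [hxy] at h, add_zero]
  | succ n ih =>
    have h' : y ∈ (stepN P (n + 1) x).support := h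
    rw [stepN, PMF.mem_support_bind_iff] at h'
    obtain ⟨z, hz, hzy⟩ := h'
    have h1 := hl x z hz
    have h2 := ih hzy
    omega

theorem green_ne_top {l : V → ℕ} (hl : ∀ x y, P x y ≠ 0 → l x < l y) (x y : V) :
    green P x y ≠ ⊤ := by
  rw [green, tsum_eq_sum (s := Finset.range (l y + 1)) fun n hn => ?_]
  · exact ENNReal.sum_ne_top.2 fun n _ => (stepN P n x).apply_ne_top y
  · by_contra h
    have := add_le_level_of_stepN_ne_zero hl h
    rw [Finset.mem_range] at hn
    omega

/-- The Green function is harmonic in its first variable away from the diagonal. -/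
theorem green_eq_pure_add_tsum (x y : V) :
    green P x y = PMF.pure x y + ∑' z, P x z * green P z y := by
  rw [green, tsum_eq_zero_add' ENNReal.summable]
  congr 1
  simp only [stepN, PMF.bind_apply, green, ← ENNReal.tsum_mul_left]
  exact ENNReal.tsum_comm

theorem stepN_mul_green_le (m : ℕ) (x y z : V) :
    stepN P m x y * green P y z ≤ green P x z := by
  rw [green, ← ENNReal.tsum_mul_left]
  refine (ENNReal.tsum_le_tsum fun n => stepN_mul_stepN_le m n x y z).trans ?_
  exact ENNReal.tsum_comp_le_tsum_of_injective (add_right_injective m) fun n => stepN P n x z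

variable {o : V} {l : V → ℕ}

theorem green_ne_zero_of_martinKernel_ne_zero {u v : V} (h : martinKernel P o v u ≠ 0) :
    green P u v ≠ 0 := fun h0 => h (by simp [martinKernel, h0])

theorem martinKernel_self (hl : ∀ x y, P x y ≠ 0 → l x < l y) (hpos : ∀ v, green P o v ≠ 0)
    (v : V) :
    martinKernel P o v o = 1 :=
  div_self (ENNReal.toReal_ne_zero.2 ⟨hpos v, green_ne_top hl o v⟩)

/-- The Martin kernels are bounded uniformly in the second variable. -/
theorem exists_martinKernel_mem_Icc (hl : ∀ x y, P x y ≠ 0 → l x < l y)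
    (hpos : ∀ v, green P o v ≠ 0) (u : V) : ∃ b : ℝ, ∀ v, martinKernel P o v u ∈ Icc 0 b := by
  obtain ⟨m, hm⟩ := not_forall.1 (mt ENNReal.tsum_eq_zero.2 (hpos u))
  have hm' : 0 < (stepN P m o u).toReal :=
    ENNReal.toReal_pos hm ((stepN P m o).apply_ne_top u)
  refine ⟨(stepN P m o u).toReal⁻¹, fun v => ⟨by unfold martinKernel; positivity, ?_⟩⟩
  have h1 := ENNReal.toReal_mono (green_ne_top hl o v) (stepN_mul_green_le (P := P) m o u v)
  rw [ENNReal.toReal_mul] at h1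
  have h2 : 0 < (green P o v).toReal := ENNReal.toReal_pos (hpos v) (green_ne_top hl o v)
  rw [martinKernel, div_le_iff₀ h2, inv_mul_eq_div, le_div_iff₀ hm']
  linarith

/-- The failure `k v - (P k) v` of harmonicity at `v` of a function `k`, for a chain with finitely
many possible steps from each point. -/
noncomputable def harmonicDefect (hfin : ∀ x, (P x).support.Finite) (v : V) (k : V → ℝ) : ℝ :=
  k v - ∑ y ∈ (hfin v).toFinset, (P v y).toReal * k y

theorem continuous_harmonicDefect (hfin : ∀ x, (P x).support.Finite) (v : V) :
    Continuous (harmonicDefect hfin v) := by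
  unfold harmonicDefect
  fun_prop

theorem harmonicDefect_martinKernel (hl : ∀ x y, P x y ≠ 0 → l x < l y)
    (hfin : ∀ x, (P x).support.Finite) (v w : V) : harmonicDefect hfin v (martinKernel P o w) =
      (PMF.pure v w).toReal / (green P o w).toReal := by
  have h := green_eq_pure_add_tsum (P := P) v w
  rw [tsum_eq_sum (s := (hfin v).toFinset) fun y hy => by
    have : P v y = 0 := by simpa [PMF.mem_support_iff] using hy
    rw [this, zero_mul]] at h
  have h1 := congrArg ENNReal.toReal h
  have hne : ∀ y ∈ (hfin v).toFinset, P v y * green P y w ≠ ⊤ := fun y _ =>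
    ENNReal.mul_ne_top ((P v).apply_ne_top y) (green_ne_top hl y w)
  rw [ENNReal.toReal_add ((PMF.pure v).apply_ne_top w) (ENNReal.sum_ne_top.2 hne),
    ENNReal.toReal_sum hne] at h1
  simp only [ENNReal.toReal_mul] at h1
  simp only [harmonicDefect, martinKernel, ← mul_div_assoc, ← Finset.sum_div, ← sub_div]
  rw [h1, add_sub_cancel_right]

theorem harmonicDefect_martinKernel_self_pos (hl : ∀ x y, P x y ≠ 0 → l x < l y)
    (hfin : ∀ x, (P x).support.Finite) (hpos : ∀ v, green P o v ≠ 0) (v : V) :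
    0 < harmonicDefect hfin v (martinKernel P o v) := by
  rw [harmonicDefect_martinKernel hl]
  have : 0 < (green P o v).toReal := ENNReal.toReal_pos (hpos v) (green_ne_top hl o v)
  simp [PMF.pure_apply, this]

theorem eq_of_harmonicDefect_martinKernel_pos (hl : ∀ x y, P x y ≠ 0 → l x < l y)
    (hfin : ∀ x, (P x).support.Finite) {v w : V}
    (h : 0 < harmonicDefect hfin v (martinKernel P o w)) : w = v := by
  rw [harmonicDefect_martinKernel hl, PMF.pure_apply] at h
  by_contra hne
  simp [hne] at h

/-- The harmonic defect of a Martin boundary function is not positive: near a function with positive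
defect at `v` there is no Martin kernel but `K(·, v)` itself. -/
theorem harmonicDefect_martinBoundary_nonpos (hl : ∀ x y, P x y ≠ 0 → l x < l y)
    (hfin : ∀ x, (P x).support.Finite) {k : V → ℝ} (hk : k ∈ MartinBoundary P o) (v : V) :
    harmonicDefect hfin v k ≤ 0 := by
  by_contra! h
  have hopen : IsOpen {k | 0 < harmonicDefect hfin v k} :=
    isOpen_lt continuous_const (continuous_harmonicDefect hfin v)
  have h1 : k ∈ closure (range (martinKernel P o) ∩ {k | 0 < harmonicDefect hfin v k}) :=
    hopen.closure_inter ⟨hk.1, h⟩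
  have h2 : range (martinKernel P o) ∩ {k | 0 < harmonicDefect hfin v k} ⊆
      {martinKernel P o v} := by
    rintro _ ⟨⟨w, rfl⟩, hw⟩
    rw [eq_of_harmonicDefect_martinKernel_pos hl hfin hw]
    rfl
  have h3 := closure_mono h2 h1
  rw [closure_singleton] at h3
  exact hk.2 ⟨v, h3.symm⟩

theorem martinBoundary_apply_base (hl : ∀ x y, P x y ≠ 0 → l x < l y)
    (hpos : ∀ v, green P o v ≠ 0) {k : V → ℝ} (hk : k ∈ MartinBoundary P o) : k o = 1 := by
  have hc : IsClosed {k : V → ℝ | k o = 1} := isClosed_eq (continuous_apply o) continuous_const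
  refine closure_minimal ?_ hc hk.1
  rintro _ ⟨v, rfl⟩
  exact martinKernel_self hl hpos v

theorem martinBoundary_nonneg {k : V → ℝ} (hk : k ∈ MartinBoundary P o) (u : V) : 0 ≤ k u := by
  have hc : IsClosed {k : V → ℝ | 0 ≤ k u} := isClosed_le continuous_const (continuous_apply u)
  refine closure_minimal ?_ hc hk.1
  rintro _ ⟨v, rfl⟩
  exact div_nonneg ENNReal.toReal_nonneg ENNReal.toReal_nonneg

/-- A Martin boundary function does not vanish identically on any set `{u | n ≤ l u}`: it is `1`
at the base point, and where it is positive it is positive after some step of the chain, which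
increases the level. -/
theorem exists_le_level_martinBoundary_ne_zero (hl : ∀ x y, P x y ≠ 0 → l x < l y)
    (hfin : ∀ x, (P x).support.Finite) (hpos : ∀ v, green P o v ≠ 0) {k : V → ℝ}
    (hk : k ∈ MartinBoundary P o) (n : ℕ) : ∃ u, n ≤ l u ∧ k u ≠ 0 := by
  induction n with
  | zero => exact ⟨o, Nat.zero_le _, by simp [martinBoundary_apply_base hl hpos hk]⟩
  | succ n ih =>
    obtain ⟨u, hu, hku⟩ := ih
    have h1 := harmonicDefect_martinBoundary_nonpos hl hfin hk u
    have h2 := (martinBoundary_nonneg hk u).lt_of_ne' hku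
    have h3 : ∑ y ∈ (hfin u).toFinset, (P u y).toReal * k y ≠ 0 := by
      unfold harmonicDefect at h1
      linarith
    obtain ⟨y, hy, hky⟩ := Finset.exists_ne_zero_of_sum_ne_zero h3
    have hPy : P u y ≠ 0 := by simpa [PMF.mem_support_iff] using hy
    exact ⟨y, by have := hl u y hPy; omega, right_ne_zero_of_mul hky⟩

/-- By compactness, the Martin kernels of vertices whose levels tend to infinity accumulate, and
they do so on the Martin boundary. -/
theorem exists_martinBoundary_mapClusterPt (hl : ∀ x y, P x y ≠ 0 → l x < l y)
    (hfin : ∀ x, (P x).support.Finite) (hpos : ∀ v, green P o v ≠ 0) {s : ℕ → V}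
    (hs : ∀ m, ∀ᶠ n in atTop, m ≤ l (s n)) :
    ∃ k ∈ MartinBoundary P o, MapClusterPt k atTop fun n => martinKernel P o (s n) := by
  choose b hb using exists_martinKernel_mem_Icc hl hpos
  have hcomp : IsCompact (Set.pi univ fun u => Icc 0 (b u)) :=
    isCompact_univ_pi fun u => isCompact_Icc
  obtain ⟨k, -, hk⟩ := hcomp.exists_mapClusterPt (f := atTop)
    (u := fun n => martinKernel P o (s n))
    (le_principal_iff.2 (mem_map.2 (univ_mem' fun n u _ => hb u (s n))))
  refine ⟨k, ⟨?_, ?_⟩, hk⟩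
  · refine mem_closure_iff_clusterPt.2 (ClusterPt.mono (show ClusterPt k (map _ _) from hk)
      (le_principal_iff.2 ?_))
    exact mem_map.2 (univ_mem' fun n => ⟨s n, rfl⟩)
  · rintro ⟨v, rfl⟩
    have hfreq := hk.frequently ((isOpen_lt continuous_const
      (continuous_harmonicDefect hfin v)).mem_nhds
        (harmonicDefect_martinKernel_self_pos hl hfin hpos v))
    obtain ⟨n, h1, h2⟩ := (hfreq.and_eventually (hs (l v + 1))).exists
    rw [eq_of_harmonicDefect_martinKernel_pos hl hfin h1] at h2
    omega

end Markov

/-! ### Walks on the tile graph and the map between the boundaries -/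

section TileWalk

open TileVertex

variable {X ι : Type*} {f : X → X} {A : ι → Set X}
  {P : TileVertex f A → PMF (TileVertex f A)}

theorem IsTileWalk.level_lt_of_ne_zero (hP : IsTileWalk P) (x y : TileVertex f A)
    (h : P x y ≠ 0) : x.level < y.level := hP.level_lt x y (pos_iff_ne_zero.2 h)

theorem IsTileWalk.finite_support [Nonempty X] [Finite ι] (hP : IsTileWalk P)
    (hA : ∀ i, (A i).Nonempty) (x : TileVertex f A) : (P x).support.Finite := by
  obtain ⟨R, -, hR⟩ := hP.bounded_step
  refine (finite_level_le (x.level + ⌈R⌉₊)).subset fun y hy => ?_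
  have h1 := level_le_add_dist hA x y
  have h2 : (tileGraph f A).dist x y ≤ ⌈R⌉₊ := by
    exact_mod_cast (show _ < R from hR x hy).le.trans (Nat.le_ceil R)
  exact h1.trans (by omega)

/-- The chain can follow the prefixes of `v`. -/
theorem IsTileWalk.green_root_ne_zero [Nonempty X] (hP : IsTileWalk P)
    (hA : ∀ i, (A i).Nonempty) (v : TileVertex f A) : green P root v ≠ 0 := by
  have key : ∀ n ≤ v.level, stepN P n root (v.take n) ≠ 0 := by
    intro n hn
    induction n with
    | zero => simp [stepN, take_zero, PMF.pure_apply]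
    | succ n ih =>
      have h1 := hP.pos_of_adj (v.take n) (v.take (n + 1)) (by rw [level_take, level_take]; omega)
        (SimpleGraph.dist_eq_one_iff_adj.2 (tileGraph_adj_take_succ hA hn).symm)
      rw [← stepN_one (P := P)] at h1
      exact ((ENNReal.mul_pos (ih (by omega)) h1.ne').trans_le
        (stepN_mul_stepN_le n 1 root _ _)).ne'
  have h := key v.level le_rfl
  rw [take_of_le le_rfl] at h
  exact fun h0 => h (ENNReal.tsum_eq_zero.1 h0 v.level)

variable [MetricSpace X] [CompactSpace X] {ξ lam : ℝ}

theorem exists_dist_le_of_walk_length_le (hf : IsOpenExpanding f ξ lam)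
    (hmesh : ∀ i, Metric.diam (A i) < ξ) (n : ℕ) :
    ∃ E : ℝ, 0 ≤ E ∧ ∀ (u v : TileVertex f A) (p : (tileGraph f A).Walk u v), p.length ≤ n →
      ∀ x ∈ u.tile, ∀ y ∈ v.tile, dist x y ≤ E * lam⁻¹ ^ u.level := by
  have hlam := hf.lam_pos
  have hD : 0 ≤ Metric.diam (univ : Set X) := Metric.diam_nonneg
  induction n with
  | zero =>
    refine ⟨_, hD, fun u v p hp x hx y hy => ?_⟩
    obtain rfl := SimpleGraph.Walk.eq_of_length_eq_zero (Nat.le_zero.1 hp)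
    exact dist_le_of_mem_tile hf hmesh u hx hy
  | succ n ih =>
    obtain ⟨E, hE, H⟩ := ih
    refine ⟨Metric.diam (univ : Set X) + E * lam, by positivity, fun u v p hp x hx y hy => ?_⟩
    cases p with
    | nil =>
      refine (dist_le_of_mem_tile hf hmesh u hx hy).trans ?_
      gcongr
      exact le_add_of_nonneg_right (by positivity)
    | @cons _ w _ hadj p =>
      obtain ⟨z, hz1, hz2⟩ := hadj.2.2
      have h1 := dist_le_of_mem_tile hf hmesh u hx hz1
      have h2 := H _ _ p (Nat.le_of_succ_le_succ hp) z hz2 y hy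
      have h3 : lam⁻¹ ^ w.level ≤ lam * lam⁻¹ ^ u.level := by
        have := pow_le_pow_of_le_one (inv_nonneg.2 hlam.le)
          (inv_lt_one_of_one_lt₀ hf.one_lt_lam).le hadj.2.1.1
        rw [pow_succ, ← div_eq_mul_inv, div_le_iff₀ hlam] at this
        linarith
      calc dist x y ≤ dist x z + dist z y := dist_triangle _ _ _
        _ ≤ Metric.diam (univ : Set X) * lam⁻¹ ^ u.level + E * (lam * lam⁻¹ ^ u.level) :=
            add_le_add h1 (h2.trans (mul_le_mul_of_nonneg_left h3 hE))
        _ = _ := by ring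

/-- All vertices that the chain can reach from `u` have their tiles within `O(lam⁻ⁿ)`, `n = |u|`,
of the tile of `u`: the single steps have length of order `lam⁻ᵐ` at level `m`, and the level
increases with each step. -/
theorem IsTileWalk.exists_dist_le_of_reflTransGen [Nonempty X] (hP : IsTileWalk P)
    (hf : IsOpenExpanding f ξ lam) (hA : ∀ i, (A i).Nonempty)
    (hmesh : ∀ i, Metric.diam (A i) < ξ) :
    ∃ C : ℝ, ∀ u v : TileVertex f A, Relation.ReflTransGen (fun a b => P a b ≠ 0) u v →
      u.level ≤ v.level ∧ ∀ x ∈ u.tile, ∀ y ∈ v.tile, dist x y ≤ C * lam⁻¹ ^ u.level := by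
  obtain ⟨R, -, hR⟩ := hP.bounded_step
  obtain ⟨E, hE, H⟩ := exists_dist_le_of_walk_length_le (A := A) hf hmesh ⌈R⌉₊
  have hθ0 : 0 ≤ lam⁻¹ := inv_nonneg.2 hf.lam_pos.le
  have hθ1 : lam⁻¹ < 1 := inv_lt_one_of_one_lt₀ hf.one_lt_lam
  -- the constant solves `E + C * lam⁻¹ = C`
  have hC : E + E / (1 - lam⁻¹) * lam⁻¹ = E / (1 - lam⁻¹) := by
    have := div_mul_cancel₀ E (show 1 - lam⁻¹ ≠ 0 by linarith)
    linear_combination -this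
  have hC0 : 0 ≤ E / (1 - lam⁻¹) := div_nonneg hE (by linarith)
  refine ⟨E / (1 - lam⁻¹), fun u v h => ?_⟩
  induction h using Relation.ReflTransGen.head_induction_on with
  | refl =>
    refine ⟨le_rfl, fun x hx y hy => ?_⟩
    refine (H v v .nil (Nat.zero_le _) x hx y hy).trans ?_
    gcongr
    linarith [mul_nonneg hC0 hθ0]
  | @head u w huw _ ih =>
    have hlev := hP.level_lt_of_ne_zero u w huw
    refine ⟨by omega, fun x hx y hy => ?_⟩
    obtain ⟨z, hz⟩ := tile_nonempty hA w
    obtain ⟨p, hp⟩ := (tileGraph_connected (f := f) hA).exists_walk_length_eq_dist u w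
    have h1 := H u w p (by
      rw [hp]
      exact_mod_cast (show _ < R from hR u huw).le.trans (Nat.le_ceil R)) x hx z hz
    have h2 := ih.2 z hz y hy
    have h3 : lam⁻¹ ^ w.level ≤ lam⁻¹ * lam⁻¹ ^ u.level := by
      rw [← pow_succ']
      exact pow_le_pow_of_le_one hθ0 hθ1.le hlev
    calc dist x y ≤ dist x z + dist z y := dist_triangle _ _ _
      _ ≤ E * lam⁻¹ ^ u.level + E / (1 - lam⁻¹) * (lam⁻¹ * lam⁻¹ ^ u.level) :=
          add_le_add h1 (h2.trans (mul_le_mul_of_nonneg_left h3 hC0))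
      _ = (E + E / (1 - lam⁻¹) * lam⁻¹) * lam⁻¹ ^ u.level := by ring
      _ = _ := by rw [hC]

/-- A Martin boundary function `k` is concentrated at a point `x` of `X`: where `k u ≠ 0`, the tile
of `u` is within `C lam⁻ⁿ`, `n = |u|`, of `x`. The point is obtained as a cluster point of tiles of
vertices `v` with `K(·, v)` close to `k`. -/
theorem exists_dist_le_of_martinBoundary_ne_zero [Nonempty X] (hA : ∀ i, (A i).Nonempty) {C : ℝ}
    (hC : ∀ u v : TileVertex f A, Relation.ReflTransGen (fun a b => P a b ≠ 0) u v →
      u.level ≤ v.level ∧ ∀ x ∈ u.tile, ∀ y ∈ v.tile, dist x y ≤ C * lam⁻¹ ^ u.level)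
    {k : TileVertex f A → ℝ} (hk : k ∈ MartinBoundary P root) :
    ∃ x : X, ∀ u, k u ≠ 0 → ∀ y ∈ u.tile, dist y x ≤ C * lam⁻¹ ^ u.level := by
  choose z hz using tile_nonempty (f := f) hA
  have hne : (comap (martinKernel P root) (𝓝 k)).NeBot := by
    refine comap_neBot_iff.2 fun t ht => ?_
    obtain ⟨_, h1, v, rfl⟩ := mem_closure_iff_nhds.1 hk.1 t ht
    exact ⟨v, h1⟩
  obtain ⟨x, hx⟩ := exists_clusterPt_of_compactSpace
    (map z (comap (martinKernel P root) (𝓝 k)))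
  refine ⟨x, fun u hu y hy => ?_⟩
  have hclosed : IsClosed {a : X | dist y a ≤ C * lam⁻¹ ^ u.level} :=
    isClosed_le (continuous_const.dist continuous_id) continuous_const
  have hev : ∀ᶠ v in comap (martinKernel P root) (𝓝 k), martinKernel P root v u ≠ 0 :=
    tendsto_comap.eventually ((continuous_apply u).continuousAt.eventually_ne hu)
  refine hclosed.closure_subset (mem_closure_iff_clusterPt.2 (hx.mono (le_principal_iff.2 ?_)))
  refine mem_map.2 ?_
  filter_upwards [hev] with v hv
  exact (hC u v (reflTransGen_of_green_ne_zero (green_ne_zero_of_martinKernel_ne_zero hv))).2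
    y hy _ (hz v)

end TileWalk

section BoundaryMap

open TileVertex GromovCompactification

variable {X ι : Type*} {f : X → X} {A : ι → Set X}
  {P : TileVertex f A → PMF (TileVertex f A)}

/-- A point of the Martin compactification as a function on the vertices. -/
noncomputable def martinFunction (p : MartinCompactification P (root : TileVertex f A)) :
    TileVertex f A → ℝ :=
  Sum.elim (martinKernel P root) Subtype.val p

theorem continuous_martinFunction : Continuous (martinFunction (P := P)) := continuous_induced_dom

/-- A vertex is an isolated point of the Martin compactification: it is the only point with
positive harmonic defect at this vertex. -/
theorem isOpen_singleton_martinCompactification {l : TileVertex f A → ℕ}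
    (hl : ∀ x y, P x y ≠ 0 → l x < l y) (hfin : ∀ x, (P x).support.Finite)
    (hpos : ∀ v, green P root v ≠ 0) (v : TileVertex f A) :
    IsOpen ({Sum.inl v} : Set (MartinCompactification P (root : TileVertex f A))) := by
  have h1 : IsOpen {p : MartinCompactification P (root : TileVertex f A) |
      0 < harmonicDefect hfin v (martinFunction p)} :=
    isOpen_lt continuous_const ((continuous_harmonicDefect hfin v).comp continuous_martinFunction)
  convert h1 using 1
  refine Subset.antisymm ?_ ?_
  · rintro _ rfl
    exact harmonicDefect_martinKernel_self_pos hl hfin hpos v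
  · rintro (w | k) hp
    · rw [eq_of_harmonicDefect_martinKernel_pos hl hfin hp]
      rfl
    · exact absurd hp (harmonicDefect_martinBoundary_nonpos hl hfin k.2 v).not_gt

variable [MetricSpace X] [CompactSpace X] {ξ lam : ℝ}
  {Ψ : GromovBoundary (tileGraph f A) root → X}

/-- A map of the Martin boundary to the Gromov boundary that sends each function to the point at
which it is concentrated extends the identity continuously. Near a boundary function `k` with
`k u ≠ 0` all functions are nonzero at `u`, which confines the corresponding vertices and boundary
points to a small neighbourhood of the tile of `u`. -/
theorem continuous_extendId [Nonempty X] [Finite ι] (hf : IsOpenExpanding f ξ lam)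
    (hA : IsMarkovPartition f A) (hmesh : ∀ i, Metric.diam (A i) < ξ) (hP : IsTileWalk P)
    (hΨ : ∀ s hs, TilesShrinkTo s (Ψ (Quot.mk _ ⟨s, hs⟩))) {C : ℝ}
    (hC : ∀ u v : TileVertex f A, Relation.ReflTransGen (fun a b => P a b ≠ 0) u v →
      u.level ≤ v.level ∧ ∀ x ∈ u.tile, ∀ y ∈ v.tile, dist x y ≤ C * lam⁻¹ ^ u.level)
    {Φ : MartinBoundary P root → GromovBoundary (tileGraph f A) root}
    (hΦ : ∀ k : MartinBoundary P root, ∀ u, k.1 u ≠ 0 → ∀ y ∈ u.tile,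
      dist y (Ψ (Φ k)) ≤ C * lam⁻¹ ^ u.level) : Continuous (extendId Φ) := by
  have hl := hP.level_lt_of_ne_zero
  have hfin := hP.finite_support hA.nonempty
  have hpos := hP.green_root_ne_zero hA.nonempty
  refine continuous_iff_continuousAt.2 ?_
  rintro (v | k)
  · have := (isOpen_singleton_martinCompactification hl hfin hpos v).mem_nhds rfl
    exact (tendsto_pure_nhds (extendId Φ) _).mono_left (le_pure_iff.2 this)
  · refine ((nhds_ofBoundary_hasBasis hf hA hmesh hΨ (Φ k)).tendsto_right_iff).2 ?_
    rintro ⟨ε, n⟩ hε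
    change 0 < ε at hε
    obtain ⟨N, hN⟩ := eventually_atTop.1
      ((hf.tendsto_inv_pow C).eventually (gt_mem_nhds (half_pos hε)))
    obtain ⟨u, hu, hku⟩ := exists_le_level_martinBoundary_ne_zero hl hfin hpos k.2 (max N n)
    have hsmall := hN u.level ((le_max_left N n).trans hu)
    have hev : ∀ᶠ p in 𝓝 (Sum.inr k : MartinCompactification P root), martinFunction p u ≠ 0 :=
      ((continuous_apply u).comp continuous_martinFunction).continuousAt.eventually_ne hku
    obtain ⟨z, hz⟩ := tile_nonempty hA.nonempty u
    have hzk := hΦ k u hku z hz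
    filter_upwards [hev]
    rintro (v | k') hp
    · have hv := hC u v
        (reflTransGen_of_green_ne_zero (green_ne_zero_of_martinKernel_ne_zero hp))
      refine ofVertex_mem_tileNhd.2 ⟨((le_max_right N n).trans hu).trans hv.1, fun y hy => ?_⟩
      have := dist_triangle_left y (Ψ (Φ k)) z
      linarith [hv.2 z hz y hy]
    · refine ofBoundary_mem_tileNhd.2 ?_
      have := dist_triangle_left (Ψ (Φ k')) (Ψ (Φ k)) z
      linarith [hΦ k' u hp z hz]

theorem continuous_of_continuous_extendId {V : Type*} {P : V → PMF V} {G : SimpleGraph V} {o : V}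
    {Φ : MartinBoundary P o → GromovBoundary G o} (h : Continuous (extendId Φ)) :
    Continuous Φ := by
  refine continuous_induced_rng.2 ?_
  let inr : MartinBoundary P o → MartinCompactification P o := Sum.inr
  have h1 : Continuous inr := continuous_induced_rng.2 continuous_subtype_val
  exact h.comp h1

/-- Every point `x` of `X` is the point of concentration of a Martin boundary function: take a
limit of Martin kernels along vertices whose tiles contain `x`. -/
theorem exists_martinBoundary_eq [Nonempty X] [Finite ι] (hf : IsOpenExpanding f ξ lam)
    (hA : IsMarkovPartition f A) (hP : IsTileWalk P) {C : ℝ}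
    (hC : ∀ u v : TileVertex f A, Relation.ReflTransGen (fun a b => P a b ≠ 0) u v →
      u.level ≤ v.level ∧ ∀ x ∈ u.tile, ∀ y ∈ v.tile, dist x y ≤ C * lam⁻¹ ^ u.level)
    {Q : MartinBoundary P root → X} (hQ : ∀ k : MartinBoundary P root, ∀ u, k.1 u ≠ 0 →
      ∀ y ∈ u.tile, dist y (Q k) ≤ C * lam⁻¹ ^ u.level) : Function.Surjective Q := by
  have hl := hP.level_lt_of_ne_zero
  have hfin := hP.finite_support hA.nonempty
  have hpos := hP.green_root_ne_zero hA.nonempty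
  intro x
  choose s hs using fun n => exists_level_eq_mem_tile hf hA n x
  obtain ⟨k, hk, hks⟩ := exists_martinBoundary_mapClusterPt hl hfin hpos (s := s) fun m => by
    filter_upwards [eventually_ge_atTop m] with n hn
    rwa [(hs n).1]
  refine ⟨⟨k, hk⟩, eq_of_forall_dist_le fun ε hε => ?_⟩
  obtain ⟨N, hN⟩ := eventually_atTop.1
    ((hf.tendsto_inv_pow C).eventually (gt_mem_nhds (half_pos hε)))
  obtain ⟨u, hu, hku⟩ := exists_le_level_martinBoundary_ne_zero hl hfin hpos hk N
  have hsmall := hN u.level hu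
  obtain ⟨n, hn⟩ := (hks.frequently
    ((continuous_apply u).continuousAt.eventually_ne hku)).exists
  obtain ⟨z, hz⟩ := tile_nonempty hA.nonempty u
  have h1 := (hC u (s n) (reflTransGen_of_green_ne_zero
    (green_ne_zero_of_martinKernel_ne_zero hn))).2 z hz x (hs n).2
  have h2 := hQ ⟨k, hk⟩ u hku z hz
  have := dist_triangle_left (Q ⟨k, hk⟩) x z
  linarith

end BoundaryMap

theorem theorem1p1 {X ι : Type*} [MetricSpace X] [CompactSpace X] [Finite ι]
    (f : X → X) (ξ lam : ℝ) (hf : IsOpenExpanding f ξ lam)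
    (A : ι → Set X) (hA : IsMarkovPartition f A) (hmesh : ∀ i, Metric.diam (A i) < ξ)
    (P : TileVertex f A → PMF (TileVertex f A)) (hP : IsTileWalk P) :
    -- the objects are well defined: the distance is finite, the Martin kernel makes sense
    (tileGraph f A).Connected ∧
    (∀ u v, green P u v ≠ ⊤) ∧ (∀ v, green P TileVertex.root v ≠ 0) ∧
    -- the tile graph is hyperbolic and its boundary is naturally homeomorphic to `X`
    GromovHyperbolic (tileGraph f A) ∧
    (∃ Ψ : GromovBoundary (tileGraph f A) TileVertex.root ≃ₜ X,
      ∀ (ζ : GromovBoundary (tileGraph f A) TileVertex.root) (s : ℕ → TileVertex f A),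
        Tendsto (fun n => GromovCompactification.ofVertex (s n)) atTop
          (𝓝 (GromovCompactification.ofBoundary ζ)) →
        Tendsto (fun n => Metric.hausdorffEDist (s n).tile {Ψ ζ}) atTop (𝓝 0)) ∧
    -- the identity extends continuously to a surjection between the boundaries
    (∃ Φ : MartinBoundary P TileVertex.root → GromovBoundary (tileGraph f A) TileVertex.root,
      Continuous Φ ∧ Function.Surjective Φ ∧ Continuous (extendId Φ)) := by
  -- A step of the chain from the empty word leads to a nonempty word, so there is some `A i`.
  have hX : Nonempty X := by
    obtain ⟨⟨u, hu⟩, huP⟩ := (P TileVertex.root).support_nonempty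
    have h := hP.level_lt_of_ne_zero _ _ huP
    cases u with
    | nil => exact absurd h (lt_irrefl _)
    | cons i u => exact (hA.nonempty i).to_subtype.map Subtype.val
  obtain ⟨Ψ, hΨ⟩ := exists_boundaryPoint hf hA.nonempty hmesh
  obtain ⟨C, hC⟩ := hP.exists_dist_le_of_reflTransGen hf hA.nonempty hmesh
  have hbij : Function.Bijective Ψ :=
    ⟨boundaryPoint_injective hf hA hΨ, boundaryPoint_surjective hf hA hmesh hΨ⟩
  choose Q hQ using fun k : MartinBoundary P (TileVertex.root : TileVertex f A) =>
    exists_dist_le_of_martinBoundary_ne_zero hA.nonempty hC k.2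
  have hΦ := continuous_extendId hf hA hmesh hP hΨ hC
    (Φ := fun k => (Equiv.ofBijective Ψ hbij).symm (Q k)) fun k => by
      rw [Equiv.ofBijective_apply_symm_apply Ψ hbij]
      exact hQ k
  exact ⟨tileGraph_connected hA.nonempty, green_ne_top hP.level_lt_of_ne_zero,
    hP.green_root_ne_zero hA.nonempty, tileGraph_gromovHyperbolic hf hA hmesh,
    ⟨(Equiv.ofBijective Ψ hbij).toHomeomorphOfIsInducing
      (boundaryPoint_isInducing hf hA hmesh hΨ),
      fun _ _ hs => tendsto_hausdorffEDist_tile hf hA hmesh hΨ hs⟩,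
    _, continuous_of_continuous_extendId hΦ,
    (Equiv.ofBijective Ψ hbij).symm.surjective.comp (exists_martinBoundary_eq hf hA hP hC hQ), hΦ⟩
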